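/- Let $a:\mathbb R\to\mathbb R$ be a $1$-periodic $C^2$ function with $a(t)>0$ and $|a'(t)|<1$ for all $t$ (for example $a(t)=\frac{\alpha}{2}+\beta\sin 2\pi t$ with $0<|\beta|<\frac{\alpha}{2}$, $|\beta|<\frac1{2\pi}$). Consider the one-dimensional cavity with a mirror at rest at $x=0$ and a moving mirror at $x=a(t)$. Let $G=(\mathrm{Id}-a)^{-1}\circ(\mathrm{Id}+a)$ be the time advance map between successive reflections of a ray from the moving mirror; it is the lift of a circle map $g:\mathbb R/\mathbb Z\to\mathbb R/\mathbb Z$. For a point $\theta$ with $g^q(\theta)=\theta$ in $\mathbb R/\mathbb Z$, the total Doppler factor along its orbit is $$D(\theta)=\prod_{i=0}^{q-1}\frac{1-a'(G^i\theta)}{1+a'(G^i\theta)} .$$ Suppose that the rotation number of the lift $G$, $\lim_{n\to\infty}(G^n(x)-x)/n$ (not reduced modulo $1$), equals $p/q$ with integers $p\ge 0$ and $q\ge1$, and that $\theta_1$ satisfies $g^q(\theta_1)=\theta_1$ and $(G^q)'(\theta_1)<1$, so that $\Theta_q=\{\theta_1,g(\theta_1),\dots,g^{q-1}(\theta_1)\}$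 is a stable periodic orbit; write $D(\Theta_q)=D(\theta_1)$. The basin of attraction of a periodic orbit is the set of points of $\mathbb R/\mathbb Z$ whose distance to the orbit tends to $0$ under iteration of $g$. Let $t_0\in\mathbb R$ and let $A$ be a classical solution of $A_{tt}-A_{xx}=0$ in $\Sigma=\{(t,x): t>t_0,\ 0<x<a(t)\}$, of class $C^2$ in $\Sigma$ and $C^1$ up to the boundary (that is, $A$, $A_t$, $A_x$ extend continuously to $\{t\ge t_0,\ 0\le x\le a(t)\}$), with $A_t(t,0)=0$ and $A_t(t,a(t))+a'(t)A_x(t,a(t))=0$ for $t>t_0$, and with energy $$E(t)=\frac1{8\pi}\int_0^{a(t)}\bigl[A_t(t,x)^2+A_x(t,x)^2\bigr]\,dx .$$ The initial field at a point $(t_0,x)$, $0\le x\le a(t_0)$, is the superposition of a right-moving part, proportional to $A_t-A_x$, whose ray first meets the moving mirror at the time $(\mathrm{Id}-a)^{-1}(t_0-x)$, and a left-moving part, proportional to $A_t+A_x$, whose ray (after reflection from the mirror at rest) first meets the moving mirror at the time $(\mathrm{Id}-a)^{-1}(t_0+x)$. Suppose that at some such point at least one of the two parts is non-zero and the phase (time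 modulo $1$) of the first reflection of its ray from the moving mirror lies in the basin of attraction of $\Theta_q$. Then $D(\Theta_q)>1$, and the energy grows at least at the exponential rate given by $D(\Theta_q)$: there is a constant $c>0$ such that for all sufficiently large $t$ $$E(t)\ \ge\ c\,\exp\Bigl\{\frac{\ln D(\Theta_q)}{p}\,t\Bigr\}.$$ Suppose moreover that $\Theta_q$ dominates among the periodic orbits reached by the field, i.e. $D(\theta')\le D(\Theta_q)$ for every $\theta'$ with $g^q(\theta')=\theta'$ whose orbit has in its basin the first-reflection phase of some ray carrying a non-zero part of the initial field. (This holds in particular if $\Theta_q$ is the only stable periodic orbit.) Then $$E(t)\ \sim\ \exp\Bigl\{\frac{\ln D(\Theta_q)}{p}\,t\Bigr\}\qquad(t\to\infty),$$ in the sense that the quotient of the two sides is bounded and bounded away from $0$ for all sufficiently large $t$. -/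

import Mathlib

open Filter Topology Asymptotics Set

noncomputable section

/-- Admissible motion `x = a t` of the moving mirror (the other mirror rests at `x = 0`; the speed
of light and the period are `1`). -/
structure IsMirrorMotion (a : ℝ → ℝ) : Prop where
  contDiff : ContDiff ℝ 2 a
  pos : ∀ t, 0 < a t
  speed : ∀ t, |deriv a t| < 1
  periodic : Function.Periodic a 1

/-- `(Id - a)⁻¹ s`: the time at which a ray that leaves the stationary mirror at time `s` reaches
the moving mirror. -/
def hitTime (a : ℝ → ℝ) (s : ℝ) : ℝ :=
  Function.invFun (fun θ => θ - a θ) s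

/-- The time advance map `G = (Id - a)⁻¹ ∘ (Id + a)` between successive reflections from the moving
mirror; it is the lift of a circle map. -/
def timeAdvance (a : ℝ → ℝ) (θ : ℝ) : ℝ :=
  hitTime a (θ + a θ)

/-- For an admissible motion `Id - a` is a strictly increasing bijection of the line, so that
`hitTime a` is its genuine inverse. -/
theorem IsMirrorMotion.bijective_sub {a : ℝ → ℝ} (ha : IsMirrorMotion a) :
    Function.Bijective (fun θ => θ - a θ) := by
  have hd : Differentiable ℝ a := ha.contDiff.differentiable (by norm_num)
  have hmono : StrictMono (fun θ => θ - a θ) := by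
    apply strictMono_of_deriv_pos
    intro x
    have h : HasDerivAt (fun θ => θ - a θ) (1 - deriv a x) x :=
      (hasDerivAt_id x).sub (hd x).hasDerivAt
    rw [h.deriv]
    have := (abs_lt.mp (ha.speed x)).2
    linarith
  have hcont : Continuous (fun θ => θ - a θ) := continuous_id.sub hd.continuous
  have hn : ∀ n : ℤ, a (n : ℝ) = a 0 := fun n => by
    simpa using ha.periodic.int_mul n 0
  refine ⟨hmono.injective, fun s => ?_⟩
  have h1 : ((⌊s⌋ : ℤ) : ℝ) - a ((⌊s⌋ : ℤ) : ℝ) ≤ s := by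
    have := Int.floor_le s
    have := ha.pos ((⌊s⌋ : ℤ) : ℝ)
    linarith
  have h2 : s ≤ ((⌈s + a 0⌉ : ℤ) : ℝ) - a ((⌈s + a 0⌉ : ℤ) : ℝ) := by
    rw [hn]
    have := Int.le_ceil (s + a 0)
    linarith
  exact mem_range_of_exists_le_of_exists_ge hcont ⟨_, h1⟩ ⟨_, h2⟩

theorem IsMirrorMotion.hitTime_sub {a : ℝ → ℝ} (ha : IsMirrorMotion a) (s : ℝ) :
    hitTime a s - a (hitTime a s) = s :=
  Function.rightInverse_invFun ha.bijective_sub.surjective s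

/-- `τ` is the rotation number of the lift `G` (not reduced modulo `1`). -/
def HasRotationNumber (G : ℝ → ℝ) (τ : ℝ) : Prop :=
  ∀ x : ℝ, Tendsto (fun n : ℕ => (G^[n] x - x) / n) atTop (𝓝 τ)

/-- `θ` is a `q`-periodic phase: `g^q (θ) = θ` in `ℝ / ℤ` for the circle map `g` with lift `G`. -/
def IsPeriodicPhase (a : ℝ → ℝ) (q : ℕ) (θ : ℝ) : Prop :=
  (((timeAdvance a)^[q] θ : ℝ) : UnitAddCircle) = (θ : UnitAddCircle)

/-- The orbit `{θ, g θ, …, g^(q-1) θ}` of a `q`-periodic phase, in the circle `ℝ / ℤ`. -/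
def phaseOrbit (a : ℝ → ℝ) (q : ℕ) (θ : ℝ) : Set UnitAddCircle :=
  (fun i : ℕ => (((timeAdvance a)^[i] θ : ℝ) : UnitAddCircle)) '' Iio q

/-- The phase of `φ` lies in the basin of attraction of the periodic orbit of `θ`. -/
def InBasin (a : ℝ → ℝ) (q : ℕ) (θ φ : ℝ) : Prop :=
  Tendsto (fun n : ℕ =>
    Metric.infDist (((timeAdvance a)^[n] φ : ℝ) : UnitAddCircle) (phaseOrbit a q θ)) atTop (𝓝 0)

/-- The Doppler factor at a reflection at time `θ`. -/
def dopplerFactor (a : ℝ → ℝ) (θ : ℝ) : ℝ :=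
  (1 - deriv a θ) / (1 + deriv a θ)

/-- The total Doppler factor along the orbit of `θ`. -/
def totalDoppler (a : ℝ → ℝ) (q : ℕ) (θ : ℝ) : ℝ :=
  ∏ i ∈ Finset.range q, dopplerFactor a ((timeAdvance a)^[i] θ)

/-- The open space-time domain `Σ` of the cavity after time `t₀`; points are pairs `(t, x)`. -/
def cavityInterior (a : ℝ → ℝ) (t₀ : ℝ) : Set (ℝ × ℝ) :=
  {z | t₀ < z.1 ∧ 0 < z.2 ∧ z.2 < a z.1}

/-- The closed space-time domain of the cavity from time `t₀` on. -/
def cavityClosure (a : ℝ → ℝ) (t₀ : ℝ) : Set (ℝ × ℝ) :=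
  {z | t₀ ≤ z.1 ∧ 0 ≤ z.2 ∧ z.2 ≤ a z.1}

/-- A classical solution `A` of the wave equation in the cavity, `C²` inside and `C¹` up to the
boundary, with perfect reflection at both mirrors. `At` and `Ax` are the partial derivatives of `A`
together with their continuous extensions to the boundary; the initial data at time `t₀` are
`A t₀` and `At t₀`. -/
structure CavityField (a : ℝ → ℝ) (t₀ : ℝ) where
  /-- the vector potential -/
  A : ℝ → ℝ → ℝ
  /-- the time derivative of the potential -/
  At : ℝ → ℝ → ℝ
  /-- the space derivative of the potential -/
  Ax : ℝ → ℝ → ℝ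
  contDiffOn : ContDiffOn ℝ 2 (fun z : ℝ × ℝ => A z.1 z.2) (cavityInterior a t₀)
  continuousOn : ContinuousOn (fun z : ℝ × ℝ => A z.1 z.2) (cavityClosure a t₀)
  continuousOn_At : ContinuousOn (fun z : ℝ × ℝ => At z.1 z.2) (cavityClosure a t₀)
  continuousOn_Ax : ContinuousOn (fun z : ℝ × ℝ => Ax z.1 z.2) (cavityClosure a t₀)
  hasDerivAt_t : ∀ t x, (t, x) ∈ cavityInterior a t₀ → HasDerivAt (fun s => A s x) (At t x) t
  hasDerivAt_x : ∀ t x, (t, x) ∈ cavityInterior a t₀ → HasDerivAt (fun y => A t y) (Ax t x) x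
  wave : ∀ t x, (t, x) ∈ cavityInterior a t₀ →
    deriv (fun s => At s x) t - deriv (fun y => Ax t y) x = 0
  stationary_mirror : ∀ t, t₀ < t → At t 0 = 0
  moving_mirror : ∀ t, t₀ < t → At t (a t) + deriv a t * Ax t (a t) = 0

/-- The energy of the field at time `t`. -/
def CavityField.energy {a : ℝ → ℝ} {t₀ : ℝ} (S : CavityField a t₀) (t : ℝ) : ℝ :=
  1 / (8 * Real.pi) * ∫ x in (0 : ℝ)..a t, (S.At t x ^ 2 + S.Ax t x ^ 2)

/-- Some ray that carries a non-zero part of the initial field is reflected from the moving mirror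
for the first time at time `φ`. The field at `(t₀, x)` is the superposition of a part moving to the
right, non-zero iff `At - Ax ≠ 0`, whose ray would have left the stationary mirror at time `t₀ - x`,
and a part moving to the left, non-zero iff `At + Ax ≠ 0`, whose ray is reflected from the
stationary mirror at time `t₀ + x` before it reaches the moving one. -/
def CavityField.FirstReflection {a : ℝ → ℝ} {t₀ : ℝ} (S : CavityField a t₀) (φ : ℝ) : Prop :=
  ∃ x ∈ Icc 0 (a t₀),
    (S.At t₀ x - S.Ax t₀ x ≠ 0 ∧ φ = hitTime a (t₀ - x)) ∨
    (S.At t₀ x + S.Ax t₀ x ≠ 0 ∧ φ = hitTime a (t₀ + x))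

end

/-- `F` is the lift of a circle diffeomorphism of degree one, with logarithmic derivative `ℓ`
that is Lipschitz with constant `L`. -/
structure IsCircleLift (F ℓ : ℝ → ℝ) (L : ℝ) : Prop where
  hasDerivAt : ∀ x, HasDerivAt F (Real.exp (ℓ x)) x
  map_add_one : ∀ x, F (x + 1) = F x + 1
  periodic_log : Function.Periodic ℓ 1
  lipschitz : ∀ x y, |ℓ x - ℓ y| ≤ L * |x - y|

namespace IsCircleLift

variable {F ℓ : ℝ → ℝ} {L : ℝ}

theorem continuous (h : IsCircleLift F ℓ L) : Continuous F :=
  continuous_iff_continuousAt.2 fun x => (h.hasDerivAt x).continuousAt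

theorem lipschitz_nonneg (h : IsCircleLift F ℓ L) : 0 ≤ L := by
  have := h.lipschitz 1 0
  have h2 := abs_nonneg (ℓ 1 - ℓ 0)
  simp at this
  linarith

theorem continuous_log (h : IsCircleLift F ℓ L) : Continuous ℓ :=
  (LipschitzWith.of_dist_le_mul (K := ⟨L, h.lipschitz_nonneg⟩) h.lipschitz).continuous

theorem strictMono (h : IsCircleLift F ℓ L) : StrictMono F :=
  strictMono_of_deriv_pos fun x => by
    rw [(h.hasDerivAt x).deriv]
    exact Real.exp_pos _

theorem map_add_int (h : IsCircleLift F ℓ L) (x : ℝ) (k : ℤ) : F (x + k) = F x + k := by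
  have hp : Function.Periodic (fun x => F x - x) 1 := fun x => by
    simp only [h.map_add_one]; ring
  have := hp.int_mul k x
  simp only [mul_one] at this
  linarith

theorem hasDerivAt_iterate (h : IsCircleLift F ℓ L) (m : ℕ) (x : ℝ) :
    HasDerivAt F^[m] (Real.exp (birkhoffSum F ℓ m x)) x := by
  induction m with
  | zero => simpa using hasDerivAt_id x
  | succ m ih =>
    rw [Function.iterate_succ', birkhoffSum_succ, Real.exp_add, mul_comm]
    exact (h.hasDerivAt _).comp x ih

theorem abs_log_bounded (h : IsCircleLift F ℓ L) : ∃ M, 0 ≤ M ∧ ∀ x, |ℓ x| ≤ M := by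
  obtain ⟨M, hM⟩ := (isCompact_Icc (a := (0 : ℝ)) (b := 1)).exists_bound_of_continuousOn
    h.continuous_log.continuousOn
  refine ⟨M, (norm_nonneg _).trans (hM 0 (by simp)), fun x => ?_⟩
  obtain ⟨y, hy, hxy⟩ := h.periodic_log.exists_mem_Ico₀ one_pos x
  rw [hxy]
  exact hM y (Ico_subset_Icc_self hy)

/-- Orbits of a lift with a fixed point are monotone and stay between fixed points at distance
one, so that they converge. -/
theorem exists_tendsto_iterate (h : IsCircleLift F ℓ L) {z : ℝ} (hz : F z = z) (x : ℝ) :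
    ∃ β, F β = β ∧ Tendsto (fun n => F^[n] x) atTop (𝓝 β) := by
  suffices H : ∃ β, Tendsto (fun n => F^[n] x) atTop (𝓝 β) by
    obtain ⟨β, hβ⟩ := H
    exact ⟨β, isFixedPt_of_tendsto_iterate hβ h.continuous.continuousAt, hβ⟩
  have hfix : ∀ k : ℤ, Function.IsFixedPt F (z + k) := fun k => by
    rw [Function.IsFixedPt, h.map_add_int, hz]
  have hmono := h.strictMono.monotone
  rcases le_total x (F x) with hx | hx
  · refine ⟨_, tendsto_atTop_ciSup (hmono.monotone_iterate_of_le_map hx)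
      ⟨z + ⌈x - z⌉, ?_⟩⟩
    rintro _ ⟨n, rfl⟩
    have h1 : x ≤ z + ⌈x - z⌉ := by linarith [Int.le_ceil (x - z)]
    calc F^[n] x ≤ F^[n] (z + ⌈x - z⌉) := hmono.iterate n h1
      _ = _ := (hfix _).iterate n
  · refine ⟨_, tendsto_atTop_ciInf (hmono.antitone_iterate_of_map_le hx)
      ⟨z + ⌊x - z⌋, ?_⟩⟩
    rintro _ ⟨n, rfl⟩
    have h1 : z + ⌊x - z⌋ ≤ x := by linarith [Int.floor_le (x - z)]
    calc z + ⌊x - z⌋ = F^[n] (z + ⌊x - z⌋) := ((hfix _).iterate n).symm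
      _ ≤ F^[n] x := hmono.iterate n h1

/-- An orbit of a lift with a fixed point stays within distance one of its starting point. -/
theorem abs_iterate_sub_le (h : IsCircleLift F ℓ L) {z : ℝ} (hz : F z = z) (x : ℝ) (n : ℕ) :
    |F^[n] x - x| ≤ 1 := by
  have hfix : ∀ k : ℤ, Function.IsFixedPt F (z + k) := fun k => by
    rw [Function.IsFixedPt, h.map_add_int, hz]
  have hmono := h.strictMono.monotone
  have h1 : z + ⌊x - z⌋ ≤ x := by linarith [Int.floor_le (x - z)]
  have h2 : x ≤ z + (⌊x - z⌋ + 1 : ℤ) := by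
    push_cast; linarith [Int.lt_floor_add_one (x - z)]
  have h3 := hmono.iterate n h1
  have h4 := hmono.iterate n h2
  rw [(hfix _).iterate n] at h3 h4
  push_cast at h2 h4
  rw [abs_le]
  constructor <;> linarith

theorem abs_sub_limit_le (h : IsCircleLift F ℓ L) {z : ℝ} (hz : F z = z) {x β : ℝ}
    (hβ : Tendsto (fun n => F^[n] x) atTop (𝓝 β)) : |x - β| ≤ 1 := by
  rw [abs_sub_comm]
  exact le_of_tendsto ((hβ.sub_const x).abs) (Eventually.of_forall (h.abs_iterate_sub_le hz x))

/-- Convergence of orbits is monotone. -/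
theorem abs_sub_limit_eq (h : IsCircleLift F ℓ L) {x β : ℝ}
    (hβ : Tendsto (fun n => F^[n] x) atTop (𝓝 β)) :
    |x - β| = |F x - x| + |F x - β| := by
  have hmono := h.strictMono.monotone
  rcases le_total x (F x) with hx | hx
  · have := (hmono.monotone_iterate_of_le_map hx).ge_of_tendsto hβ 1
    simp only [Function.iterate_one] at this
    rw [abs_of_nonpos (by linarith : x - β ≤ 0), abs_of_nonneg (by linarith : 0 ≤ F x - x),
      abs_of_nonpos (by linarith : F x - β ≤ 0)]
    ring
  · have := (hmono.antitone_iterate_of_map_le hx).le_of_tendsto hβ 1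
    simp only [Function.iterate_one] at this
    rw [abs_of_nonneg (by linarith : 0 ≤ x - β), abs_of_nonpos (by linarith : F x - x ≤ 0),
      abs_of_nonneg (by linarith : 0 ≤ F x - β)]
    ring

theorem abs_map_sub_le (h : IsCircleLift F ℓ L) {z x ν : ℝ} (hz : F z = z)
    (hν : ∀ y, |y - z| ≤ |x - z| → ℓ y ≤ ν) : |F x - z| ≤ Real.exp ν * |x - z| := by
  have := (convex_closedBall z |x - z|).norm_image_sub_le_of_norm_hasDerivWithin_le
    (f := F) (f' := fun y => Real.exp (ℓ y)) (C := Real.exp ν) (x := z) (y := x)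
    (fun y _ => (h.hasDerivAt y).hasDerivWithinAt)
    (fun y hy => by
      rw [Real.norm_of_nonneg (Real.exp_pos _).le]
      exact Real.exp_le_exp.2 (hν y hy))
    (Metric.mem_closedBall_self (abs_nonneg _)) (by simp [Real.dist_eq])
  rwa [hz] at this

/-- Near a fixed point with derivative at most `exp (-μ)`, the lift contracts. -/
theorem abs_map_sub_le_of_near (h : IsCircleLift F ℓ L) {z x μ ε : ℝ} (hz : F z = z)
    (hε : L * ε ≤ μ / 2) (hzμ : μ + ℓ z ≤ 0) (hx : |x - z| ≤ ε) :
    |F x - z| ≤ Real.exp (-(μ / 2)) * |x - z| := by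
  refine h.abs_map_sub_le hz fun y hy => ?_
  have h1 := (le_abs_self _).trans (h.lipschitz y z)
  have h2 : L * |y - z| ≤ L * ε := mul_le_mul_of_nonneg_left (hy.trans hx) h.lipschitz_nonneg
  linarith

theorem abs_iterate_sub_le_of_near (h : IsCircleLift F ℓ L) {z x μ ε : ℝ} (hz : F z = z)
    (hμ : 0 < μ) (hε : L * ε ≤ μ / 2) (hzμ : μ + ℓ z ≤ 0) (hx : |x - z| ≤ ε) (n : ℕ) :
    |F^[n] x - z| ≤ Real.exp (-(μ / 2)) ^ n * |x - z| := by
  have hρ : Real.exp (-(μ / 2)) ≤ 1 := Real.exp_le_one_iff.2 (by linarith)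
  induction n with
  | zero => simp
  | succ n ih =>
    have h1 : Real.exp (-(μ / 2)) ^ n * |x - z| ≤ |x - z| :=
      mul_le_of_le_one_left (abs_nonneg _) (pow_le_one₀ (Real.exp_pos _).le hρ)
    rw [Function.iterate_succ_apply', pow_succ', mul_assoc]
    exact (h.abs_map_sub_le_of_near hz hε hzμ (ih.trans (h1.trans hx))).trans
      (mul_le_mul_of_nonneg_left ih (Real.exp_pos _).le)

theorem tendsto_iterate_of_near (h : IsCircleLift F ℓ L) {z x μ ε : ℝ} (hz : F z = z)
    (hμ : 0 < μ) (hε : L * ε ≤ μ / 2) (hzμ : μ + ℓ z ≤ 0) (hx : |x - z| ≤ ε) :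
    Tendsto (fun n => F^[n] x) atTop (𝓝 z) := by
  rw [tendsto_iff_dist_tendsto_zero]
  have hρ : Real.exp (-(μ / 2)) < 1 := Real.exp_lt_one_iff.2 (by linarith)
  have h1 := (tendsto_pow_atTop_nhds_zero_of_lt_one (Real.exp_pos (-(μ / 2))).le hρ).mul_const
    |x - z|
  rw [zero_mul] at h1
  exact squeeze_zero (fun _ => dist_nonneg)
    (fun n => h.abs_iterate_sub_le_of_near hz hμ hε hzμ hx n) h1

/-- Away from the fixed points with derivative at most `exp (-μ)`, the displacement is bounded
below wherever the derivative is at most `exp (-μ)`. -/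
theorem exists_le_abs_map_sub (h : IsCircleLift F ℓ L) (μ ε : ℝ) (hε0 : 0 < ε) :
    ∃ η, 0 < η ∧ ∀ x, μ + ℓ x ≤ 0 → (∀ z, F z = z → μ + ℓ z ≤ 0 → ε ≤ |x - z|) →
      η ≤ |F x - x| := by
  have hc := h.continuous
  have hl := h.continuous_log
  set K : Set ℝ := {z | F z = z ∧ μ + ℓ z ≤ 0}
  set B : Set ℝ := Icc 0 1 ∩ ({x | μ + ℓ x ≤ 0} ∩ ⋂ z ∈ K, {x | ε ≤ |x - z|})
  have hB : IsCompact B := by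
    refine isCompact_Icc.inter_right ((isClosed_le (by fun_prop) (by fun_prop)).inter ?_)
    exact isClosed_biInter fun z _ => isClosed_le (by fun_prop) (by fun_prop)
  obtain ⟨η, hη, hηB⟩ := hB.exists_forall_le' (f := fun x => |F x - x|) (a := 0)
    (by fun_prop) (fun x hx => by
      rw [abs_pos, sub_ne_zero]
      intro hfix
      have := mem_iInter₂.1 hx.2.2 x ⟨hfix, hx.2.1⟩
      simp only [mem_ofPred_eq, sub_self, abs_zero] at this
      linarith)
  refine ⟨η, hη, fun x hx hxz => ?_⟩
  have hℓ : ∀ y, ∀ k : ℤ, ℓ (y + k) = ℓ y := fun y k => by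
    simpa using h.periodic_log.int_mul k y
  have hfr : Int.fract x = x + (-⌊x⌋ : ℤ) := by
    push_cast; rw [← sub_eq_add_neg]; rfl
  have := hηB (Int.fract x) ⟨⟨Int.fract_nonneg x, (Int.fract_lt_one x).le⟩, ?_, ?_⟩
  · rw [hfr, h.map_add_int] at this
    simpa using this
  · rw [hfr, mem_ofPred_eq, hℓ]; exact hx
  · refine mem_iInter₂.2 fun z hz => ?_
    have := hxz (z + ⌊x⌋) (by rw [h.map_add_int, hz.1]) (by rw [hℓ]; exact hz.2)
    rw [mem_ofPred_eq]
    convert this using 2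
    rw [← Int.self_sub_floor]; ring

/-- If the derivative at the limit of an orbit is at least `exp (-μ)`, then the derivative of the
`m`-th iterate is bounded below by a uniform multiple of `exp (-μ m)`. -/
theorem birkhoffSum_ge (h : IsCircleLift F ℓ L) {z₀ : ℝ} (hz₀ : F z₀ = z₀) {μ : ℝ} (hμ : 0 < μ) :
    ∃ C, ∀ x β, Tendsto (fun n => F^[n] x) atTop (𝓝 β) → 0 ≤ μ + ℓ β →
      ∀ m : ℕ, -C - μ * m ≤ birkhoffSum F ℓ m x := by
  have hL := h.lipschitz_nonneg
  obtain ⟨M, hM0, hM⟩ := h.abs_log_bounded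
  set ε : ℝ := μ / (2 * (L + 1)) with hεdef
  have hε0 : 0 < ε := by positivity
  have hε : L * ε ≤ μ / 2 := by
    have : (L + 1) * ε = μ / 2 := by rw [hεdef]; field_simp
    nlinarith
  obtain ⟨η, hη, hηx⟩ := h.exists_le_abs_map_sub μ ε hε0
  set ρ := Real.exp (-(μ / 2)) with hρdef
  have hρ : ρ < 1 := Real.exp_lt_one_iff.2 (by linarith)
  set C := M / η + L / (1 - ρ) with hCdef
  have hC1 : 0 ≤ M / η := by positivity
  have hC2 : 0 ≤ L / (1 - ρ) := div_nonneg hL (by linarith)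
  have step : ∀ x β, Tendsto (fun n => F^[n] x) atTop (𝓝 β) → 0 ≤ μ + ℓ β →
      C * (|F x - β| - |x - β|) ≤ μ + ℓ x := by
    intro x β hβ hβμ
    have hdist := h.abs_sub_limit_eq hβ
    have habs := abs_nonneg (F x - x)
    rcases le_total 0 (μ + ℓ x) with hx | hx
    · refine le_trans ?_ hx
      exact mul_nonpos_of_nonneg_of_nonpos (add_nonneg hC1 hC2) (by linarith)
    by_cases hnear : ∃ z, F z = z ∧ μ + ℓ z ≤ 0 ∧ |x - z| < ε
    · obtain ⟨z, hz, hzμ, hxz⟩ := hnear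
      obtain rfl := tendsto_nhds_unique hβ (h.tendsto_iterate_of_near hz hμ hε hzμ hxz.le)
      have h1 := h.abs_map_sub_le_of_near hz hε hzμ hxz.le
      rw [← hρdef] at h1
      have h2 := (neg_abs_le _).trans' (neg_le_neg (h.lipschitz x β))
      have h3 : L / (1 - ρ) * ((1 - ρ) * |x - β|) = L * |x - β| := by
        field_simp [show (1 - ρ) ≠ 0 by linarith]
      have h4 : L / (1 - ρ) * ((1 - ρ) * |x - β|) ≤ L / (1 - ρ) * (|x - β| - |F x - β|) :=
        mul_le_mul_of_nonneg_left (by linarith) hC2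
      have h5 : 0 ≤ M / η * (|x - β| - |F x - β|) := mul_nonneg hC1 (by linarith)
      rw [hCdef]
      nlinarith
    · push Not at hnear
      have h1 := hηx x hx hnear
      have h2 : M ≤ M / η * |F x - x| := by
        calc M = M / η * η := by field_simp
          _ ≤ _ := mul_le_mul_of_nonneg_left h1 hC1
      have h3 := (abs_le.1 (hM x)).1
      have h5 : 0 ≤ L / (1 - ρ) * |F x - x| := mul_nonneg hC2 habs
      have h6 : |F x - β| - |x - β| = -|F x - x| := by linarith
      rw [hCdef, h6]
      nlinarith
  have sum : ∀ (m : ℕ) x β, Tendsto (fun n => F^[n] x) atTop (𝓝 β) → 0 ≤ μ + ℓ β →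
      C * (|F^[m] x - β| - |x - β|) ≤ μ * m + birkhoffSum F ℓ m x := by
    intro m
    induction m with
    | zero => simp
    | succ m ih =>
      intro x β hβ hβμ
      have hβ' : Tendsto (fun n => F^[n] (F x)) atTop (𝓝 β) := by
        simpa only [← Function.iterate_succ_apply] using (tendsto_add_atTop_iff_nat 1).2 hβ
      have h1 := step x β hβ hβμ
      have h2 := ih (F x) β hβ' hβμ
      rw [Function.iterate_succ_apply, birkhoffSum_succ']
      push_cast
      linarith
  refine ⟨C, fun x β hβ hβμ m => ?_⟩
  have h1 := sum m x β hβ hβμ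
  have h2 := h.abs_sub_limit_le hz₀ hβ
  have h3 : -C ≤ C * (|F^[m] x - β| - |x - β|) := by
    have h4 := abs_nonneg (F^[m] x - β)
    have h5 : 0 ≤ C := add_nonneg hC1 hC2
    nlinarith
  linarith

/-- Near a point of the basin of an attracting fixed point with derivative `exp (-μ)`, the
derivative of the `m`-th iterate is at most a uniform multiple of `exp (-μ m)`. -/
theorem birkhoffSum_le_near (h : IsCircleLift F ℓ L) {β : ℝ} (hβ : F β = β) {μ : ℝ} (hμ : 0 < μ)
    (hβμ : μ + ℓ β = 0) {φ : ℝ} (hφ : Tendsto (fun n => F^[n] φ) atTop (𝓝 β)) :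
    ∃ C, ∀ᶠ x in 𝓝 φ, ∀ m : ℕ, birkhoffSum F ℓ m x ≤ C - μ * m := by
  have hL := h.lipschitz_nonneg
  obtain ⟨M, hM0, hM⟩ := h.abs_log_bounded
  set ε : ℝ := μ / (2 * (L + 1)) with hεdef
  have hε0 : 0 < ε := by positivity
  have hε : L * ε ≤ μ / 2 := by
    have : (L + 1) * ε = μ / 2 := by rw [hεdef]; field_simp
    nlinarith
  set ρ := Real.exp (-(μ / 2)) with hρdef
  have hρ : ρ < 1 := Real.exp_lt_one_iff.2 (by linarith)
  have hC2 : 0 ≤ L / (1 - ρ) := div_nonneg hL (by linarith)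
  have near : ∀ (m : ℕ) x, |x - β| ≤ ε →
      μ * m + birkhoffSum F ℓ m x ≤ L / (1 - ρ) * (|x - β| - |F^[m] x - β|) := by
    intro m
    induction m with
    | zero => simp
    | succ m ih =>
      intro x hx
      have h1 := h.abs_map_sub_le_of_near hβ hε hβμ.le hx
      rw [← hρdef] at h1
      have h0 : ρ * |x - β| ≤ |x - β| := mul_le_of_le_one_left (abs_nonneg _) hρ.le
      have h2 := ih (F x) ((h1.trans h0).trans hx)
      have h3 : L / (1 - ρ) * ((1 - ρ) * |x - β|) = L * |x - β| := by
        field_simp [show (1 - ρ) ≠ 0 by linarith]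
      have h4 : L / (1 - ρ) * ((1 - ρ) * |x - β|) ≤ L / (1 - ρ) * (|x - β| - |F x - β|) :=
        mul_le_mul_of_nonneg_left (by linarith) hC2
      have h5 := (le_abs_self _).trans (h.lipschitz x β)
      rw [Function.iterate_succ_apply, birkhoffSum_succ']
      push_cast
      nlinarith
  have lift : ∀ (N : ℕ) (x : ℝ), |F^[N] x - β| ≤ ε → ∀ m : ℕ,
      birkhoffSum F ℓ m x ≤ (L / (1 - ρ) * ε + (M + μ) * N) - μ * m := by
    intro N
    induction N with
    | zero =>
      intro x hx m
      simp only [Function.iterate_zero, id] at hx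
      have h1 := near m x hx
      have h2 : L / (1 - ρ) * (|x - β| - |F^[m] x - β|) ≤ L / (1 - ρ) * ε :=
        mul_le_mul_of_nonneg_left (by linarith [abs_nonneg (F^[m] x - β)]) hC2
      simp
      linarith
    | succ N ih =>
      intro x hx m
      cases m with
      | zero =>
        have : 0 ≤ L / (1 - ρ) * ε := by positivity
        have : 0 ≤ (M + μ) * (N + 1 : ℕ) := by positivity
        simp only [birkhoffSum_zero, Nat.cast_zero, mul_zero, sub_zero]
        linarith
      | succ m =>
        have h1 := ih (F x) hx m
        have h2 := (abs_le.1 (hM x)).2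
        rw [birkhoffSum_succ']
        push_cast
        linarith
  obtain ⟨N, hN⟩ := (hφ.eventually (Metric.ball_mem_nhds β hε0)).exists
  have hopen : ∀ᶠ x in 𝓝 φ, |F^[N] x - β| ≤ ε := by
    have hc := (h.continuous.iterate N).continuousAt (x := φ)
    filter_upwards [hc.eventually (Metric.isOpen_ball.mem_nhds hN)] with x hx
    exact (Metric.mem_ball.1 hx).le
  exact ⟨_, hopen.mono fun x hx => lift N x hx⟩

end IsCircleLift

/-- A `C²` lift with positive derivative satisfies `IsCircleLift`. -/
theorem IsCircleLift.of_contDiff {F : ℝ → ℝ} (hF : ContDiff ℝ 2 F) (hpos : ∀ x, 0 < deriv F x)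
    (hadd : ∀ x, F (x + 1) = F x + 1) :
    ∃ L, IsCircleLift F (fun x => Real.log (deriv F x)) L := by
  have hd : Differentiable ℝ F := hF.differentiable (by norm_num)
  have hd1 : ContDiff ℝ 1 (deriv F) := (contDiff_succ_iff_deriv (n := 1)).1 hF |>.2.2
  have hlog : ContDiff ℝ 1 (fun x => Real.log (deriv F x)) := hd1.log fun x => (hpos x).ne'
  have hper : Function.Periodic (deriv F) 1 := fun x => by
    rw [← deriv_comp_add_const, funext hadd, deriv_add_const]
  have hperl : Function.Periodic (fun x => Real.log (deriv F x)) 1 := fun x => by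
    simp only [hper x]
  have hper' : Function.Periodic (deriv (fun x => Real.log (deriv F x))) 1 := fun x => by
    rw [← deriv_comp_add_const, funext hperl]
  obtain ⟨L, hL⟩ := (isCompact_Icc (a := (0 : ℝ)) (b := 1)).exists_bound_of_continuousOn
    (hlog.continuous_deriv le_rfl).continuousOn
  refine ⟨L, fun x => ?_, hadd, hperl, fun x y => ?_⟩
  · rw [Real.exp_log (hpos x)]
    exact (hd x).hasDerivAt
  · refine convex_univ.norm_image_sub_le_of_norm_deriv_le
      (fun t _ => hlog.differentiable one_ne_zero t) (fun t _ => ?_) (mem_univ y) (mem_univ x)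
    obtain ⟨s, hs, hts⟩ := hper'.exists_mem_Ico₀ one_pos t
    rw [hts]
    exact hL s (Ico_subset_Icc_self hs)

namespace IsMirrorMotion

variable {a : ℝ → ℝ}

theorem differentiable (ha : IsMirrorMotion a) : Differentiable ℝ a :=
  ha.contDiff.differentiable (by norm_num)

theorem one_sub_pos (ha : IsMirrorMotion a) (t : ℝ) : 0 < 1 - deriv a t := by
  linarith [(abs_lt.1 (ha.speed t)).2]

theorem one_add_pos (ha : IsMirrorMotion a) (t : ℝ) : 0 < 1 + deriv a t := by
  linarith [(abs_lt.1 (ha.speed t)).1]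

theorem continuous_deriv (ha : IsMirrorMotion a) : Continuous (deriv a) :=
  ha.contDiff.continuous_deriv (by norm_num)

theorem periodic_deriv (ha : IsMirrorMotion a) : Function.Periodic (deriv a) 1 := fun x => by
  rw [← deriv_comp_add_const, funext ha.periodic]

theorem deriv_add_int (ha : IsMirrorMotion a) (t : ℝ) (k : ℤ) :
    deriv a (t + k) = deriv a t := by
  simpa using ha.periodic_deriv.int_mul k t

theorem hasDerivAt_sub (ha : IsMirrorMotion a) (t : ℝ) :
    HasDerivAt (fun θ => θ - a θ) (1 - deriv a t) t :=
  (hasDerivAt_id t).sub (ha.differentiable t).hasDerivAt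

theorem hasDerivAt_add (ha : IsMirrorMotion a) (t : ℝ) :
    HasDerivAt (fun θ => θ + a θ) (1 + deriv a t) t :=
  (hasDerivAt_id t).add (ha.differentiable t).hasDerivAt

theorem strictMono_sub (ha : IsMirrorMotion a) : StrictMono (fun θ => θ - a θ) :=
  strictMono_of_deriv_pos fun x => by rw [(ha.hasDerivAt_sub x).deriv]; exact ha.one_sub_pos x

theorem strictMono_add (ha : IsMirrorMotion a) : StrictMono (fun θ => θ + a θ) :=
  strictMono_of_deriv_pos fun x => by rw [(ha.hasDerivAt_add x).deriv]; exact ha.one_add_pos x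

theorem hitTime_of_sub (ha : IsMirrorMotion a) (θ : ℝ) : hitTime a (θ - a θ) = θ :=
  Function.leftInverse_invFun ha.bijective_sub.injective θ

theorem strictMono_hitTime (ha : IsMirrorMotion a) : StrictMono (hitTime a) := fun s t hst => by
  rw [← ha.strictMono_sub.lt_iff_lt]
  simpa only [ha.hitTime_sub] using hst

theorem contDiff_hitTime (ha : IsMirrorMotion a) : ContDiff ℝ 2 (hitTime a) := by
  let f := (ha.strictMono_sub.orderIsoOfSurjective _
    ha.bijective_sub.surjective).toHomeomorph.toOpenPartialHomeomorph
  have hf : ∀ s, f.symm s = hitTime a s := fun s =>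
    ha.bijective_sub.injective <| by
      rw [ha.hitTime_sub]
      exact f.right_inv (mem_univ s)
  refine contDiff_iff_contDiffAt.2 fun s => ?_
  have := f.contDiffAt_symm_deriv (n := 2) (ha.one_sub_pos (f.symm s)).ne' (mem_univ s)
    (ha.hasDerivAt_sub _) (contDiff_id.sub ha.contDiff).contDiffAt
  exact this.congr_of_eventuallyEq (Eventually.of_forall fun s => (hf s).symm)

theorem continuous_hitTime (ha : IsMirrorMotion a) : Continuous (hitTime a) :=
  ha.contDiff_hitTime.continuous

theorem hasDerivAt_hitTime (ha : IsMirrorMotion a) (s : ℝ) :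
    HasDerivAt (hitTime a) (1 - deriv a (hitTime a s))⁻¹ s :=
  HasDerivAt.of_local_left_inverse ha.continuous_hitTime.continuousAt (ha.hasDerivAt_sub _)
    (ha.one_sub_pos _).ne' (Eventually.of_forall ha.hitTime_sub)

theorem hitTime_add_one (ha : IsMirrorMotion a) (s : ℝ) : hitTime a (s + 1) = hitTime a s + 1 := by
  refine ha.bijective_sub.injective ?_
  simp only [ha.hitTime_sub, ha.periodic (hitTime a s)]
  linarith [ha.hitTime_sub s]

theorem timeAdvance_sub (ha : IsMirrorMotion a) (θ : ℝ) :
    timeAdvance a θ - a (timeAdvance a θ) = θ + a θ :=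
  ha.hitTime_sub _

theorem contDiff_timeAdvance (ha : IsMirrorMotion a) : ContDiff ℝ 2 (timeAdvance a) :=
  ha.contDiff_hitTime.comp (contDiff_id.add ha.contDiff)

theorem hasDerivAt_timeAdvance (ha : IsMirrorMotion a) (θ : ℝ) :
    HasDerivAt (timeAdvance a) ((1 + deriv a θ) / (1 - deriv a (timeAdvance a θ))) θ := by
  rw [div_eq_inv_mul]
  exact (ha.hasDerivAt_hitTime (θ + a θ)).comp θ (ha.hasDerivAt_add θ)

theorem timeAdvance_add_one (ha : IsMirrorMotion a) (θ : ℝ) :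
    timeAdvance a (θ + 1) = timeAdvance a θ + 1 := by
  unfold timeAdvance
  rw [ha.periodic, ← ha.hitTime_add_one]
  ring_nf

theorem lt_timeAdvance (ha : IsMirrorMotion a) (θ : ℝ) : θ < timeAdvance a θ := by
  linarith [ha.timeAdvance_sub θ, ha.pos θ, ha.pos (timeAdvance a θ)]

theorem exists_isCircleLift_timeAdvance (ha : IsMirrorMotion a) :
    ∃ ℓ L, IsCircleLift (timeAdvance a) ℓ L := by
  obtain ⟨L, hL⟩ := IsCircleLift.of_contDiff ha.contDiff_timeAdvance (fun x => by
    rw [(ha.hasDerivAt_timeAdvance x).deriv]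
    exact div_pos (ha.one_add_pos _) (ha.one_sub_pos _)) ha.timeAdvance_add_one
  exact ⟨_, L, hL⟩

theorem strictMono_timeAdvance (ha : IsMirrorMotion a) : StrictMono (timeAdvance a) := by
  obtain ⟨ℓ, L, h⟩ := ha.exists_isCircleLift_timeAdvance
  exact h.strictMono

theorem continuous_timeAdvance (ha : IsMirrorMotion a) : Continuous (timeAdvance a) :=
  ha.contDiff_timeAdvance.continuous

theorem iterate_timeAdvance_add_int (ha : IsMirrorMotion a) (n : ℕ) (θ : ℝ) (k : ℤ) :
    (timeAdvance a)^[n] (θ + k) = (timeAdvance a)^[n] θ + k := by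
  obtain ⟨ℓ, L, h⟩ := ha.exists_isCircleLift_timeAdvance
  exact ((show Function.Commute (timeAdvance a) (· + (k : ℝ)) from
    fun x => h.map_add_int x k).iterate_left n) θ

theorem lt_iterate_timeAdvance (ha : IsMirrorMotion a) {n : ℕ} (hn : 0 < n) (θ : ℝ) :
    θ < (timeAdvance a)^[n] θ := by
  have h := ha.strictMono_timeAdvance.strictMono_iterate_of_lt_map (ha.lt_timeAdvance θ) hn
  simpa using h

theorem dopplerFactor_pos (ha : IsMirrorMotion a) (θ : ℝ) : 0 < dopplerFactor a θ :=
  div_pos (ha.one_sub_pos θ) (ha.one_add_pos θ)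

theorem dopplerFactor_add_int (ha : IsMirrorMotion a) (θ : ℝ) (k : ℤ) :
    dopplerFactor a (θ + k) = dopplerFactor a θ := by
  simp only [dopplerFactor, ha.deriv_add_int]

theorem continuous_dopplerFactor (ha : IsMirrorMotion a) : Continuous (dopplerFactor a) :=
  (continuous_const.sub ha.continuous_deriv).div (continuous_const.add ha.continuous_deriv)
    fun θ => (ha.one_add_pos θ).ne'

theorem totalDoppler_pos (ha : IsMirrorMotion a) (n : ℕ) (θ : ℝ) : 0 < totalDoppler a n θ :=
  Finset.prod_pos fun _ _ => ha.dopplerFactor_pos _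

theorem hasDerivAt_iterate_timeAdvance (ha : IsMirrorMotion a) (n : ℕ) (θ : ℝ) :
    HasDerivAt (timeAdvance a)^[n]
      ((1 - deriv a θ) / ((1 - deriv a ((timeAdvance a)^[n] θ)) * totalDoppler a n θ)) θ := by
  induction n with
  | zero =>
    have := (ha.one_sub_pos θ).ne'
    simpa [totalDoppler, this] using hasDerivAt_id θ
  | succ n ih =>
    have h := (ha.hasDerivAt_timeAdvance ((timeAdvance a)^[n] θ)).comp θ ih
    rw [Function.iterate_succ', totalDoppler, Finset.prod_range_succ, ← totalDoppler]
    refine h.congr_deriv ?_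
    have h1 := (ha.one_sub_pos ((timeAdvance a)^[n] θ)).ne'
    have h2 := (ha.one_add_pos ((timeAdvance a)^[n] θ)).ne'
    have h3 := (ha.one_sub_pos (timeAdvance a ((timeAdvance a)^[n] θ))).ne'
    have h4 := (ha.totalDoppler_pos n θ).ne'
    simp only [dopplerFactor, Function.comp]
    field_simp

theorem totalDoppler_add_int (ha : IsMirrorMotion a) (n : ℕ) (θ : ℝ) (k : ℤ) :
    totalDoppler a n (θ + k) = totalDoppler a n θ := by
  simp only [totalDoppler, ha.iterate_timeAdvance_add_int, ha.dopplerFactor_add_int]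

theorem totalDoppler_iterate (ha : IsMirrorMotion a) {q : ℕ} {θ : ℝ} {k : ℤ}
    (hθ : (timeAdvance a)^[q] θ = θ + k) (i : ℕ) :
    totalDoppler a q ((timeAdvance a)^[i] θ) = totalDoppler a q θ := by
  induction i generalizing θ with
  | zero => rfl
  | succ i ih =>
    rw [Function.iterate_succ_apply, ih]
    · have h1 : totalDoppler a (q + 1) θ = totalDoppler a q θ * dopplerFactor a θ := by
        rw [totalDoppler, Finset.prod_range_succ, hθ, ha.dopplerFactor_add_int]; rfl
      have h2 : totalDoppler a (q + 1) θ =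
          totalDoppler a q (timeAdvance a θ) * dopplerFactor a θ := by
        rw [totalDoppler, Finset.prod_range_succ']; rfl
      exact mul_right_cancel₀ (ha.dopplerFactor_pos θ).ne' (h2.symm.trans h1)
    · rw [← Function.iterate_succ_apply, Function.iterate_succ_apply', hθ]
      simpa using ha.iterate_timeAdvance_add_int 1 θ k

end IsMirrorMotion

/-- The lift of `g ^ q` obtained by subtracting `p` turns from the `q`-th iterate of the time
advance map. -/
noncomputable def returnMap (a : ℝ → ℝ) (q p : ℕ) (θ : ℝ) : ℝ :=
  (timeAdvance a)^[q] θ - p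

namespace IsMirrorMotion

variable {a : ℝ → ℝ} {q p : ℕ}

theorem returnMap_eq_iff {θ : ℝ} : returnMap a q p θ = θ ↔ (timeAdvance a)^[q] θ = θ + p :=
  sub_eq_iff_eq_add

theorem iterate_returnMap (ha : IsMirrorMotion a) (m : ℕ) (θ : ℝ) :
    (returnMap a q p)^[m] θ = (timeAdvance a)^[q * m] θ - p * m := by
  induction m with
  | zero => simp
  | succ m ih =>
    rw [Function.iterate_succ_apply', ih, returnMap, Nat.mul_succ, add_comm (q * m),
      Function.iterate_add_apply]
    have := ha.iterate_timeAdvance_add_int q ((timeAdvance a)^[q * m] θ) (-(p * m : ℤ))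
    push_cast at this ⊢
    rw [sub_eq_add_neg ((timeAdvance a)^[q * m] θ), this]
    ring

theorem exists_isCircleLift_returnMap (ha : IsMirrorMotion a) (q p : ℕ) :
    ∃ ℓ L, IsCircleLift (returnMap a q p) ℓ L := by
  have hc : ∀ n : ℕ, ContDiff ℝ 2 (timeAdvance a)^[n] := fun n => by
    induction n with
    | zero => exact contDiff_id
    | succ n ih =>
      rw [Function.iterate_succ']
      exact ha.contDiff_timeAdvance.comp ih
  obtain ⟨L, hL⟩ := IsCircleLift.of_contDiff (F := returnMap a q p) ((hc q).sub contDiff_const)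
    (fun x => by
      unfold returnMap
      rw [((ha.hasDerivAt_iterate_timeAdvance q x).sub_const _).deriv]
      exact div_pos (ha.one_sub_pos _) (mul_pos (ha.one_sub_pos _) (ha.totalDoppler_pos _ _)))
    (fun x => by
      have := ha.iterate_timeAdvance_add_int q x 1
      rw [Int.cast_one] at this
      simp only [returnMap, this]
      ring)
  exact ⟨_, L, hL⟩

theorem log_deriv_returnMap (ha : IsMirrorMotion a) {ℓ : ℝ → ℝ} {L : ℝ}
    (h : IsCircleLift (returnMap a q p) ℓ L) {β : ℝ} (hβ : returnMap a q p β = β) :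
    ℓ β = -Real.log (totalDoppler a q β) := by
  have h1 := (h.hasDerivAt β).unique ((ha.hasDerivAt_iterate_timeAdvance q β).sub_const _)
  have h2 := ha.deriv_add_int β p
  rw [Int.cast_natCast] at h2
  rw [returnMap_eq_iff.1 hβ, h2, div_mul_cancel_left₀ (ha.one_sub_pos β).ne'] at h1
  rw [← Real.log_inv, ← h1, Real.log_exp]

/-- The derivative of iterates of the return map and total Doppler factors. -/
theorem totalDoppler_mul_exp (ha : IsMirrorMotion a) {ℓ : ℝ → ℝ} {L : ℝ}
    (h : IsCircleLift (returnMap a q p) ℓ L) (m : ℕ) (θ : ℝ) :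
    totalDoppler a (q * m) θ * (1 - deriv a ((timeAdvance a)^[q * m] θ)) =
      (1 - deriv a θ) * Real.exp (-birkhoffSum (returnMap a q p) ℓ m θ) := by
  have h1 := h.hasDerivAt_iterate m θ
  rw [funext (ha.iterate_returnMap (q := q) (p := p) m)] at h1
  have h2 := h1.unique ((ha.hasDerivAt_iterate_timeAdvance (q * m) θ).sub_const _)
  rw [Real.exp_neg, h2]
  have := (ha.totalDoppler_pos (q * m) θ).ne'
  have := (ha.one_sub_pos θ).ne'
  have := (ha.one_sub_pos ((timeAdvance a)^[q * m] θ)).ne'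
  field_simp

end IsMirrorMotion

theorem UnitAddCircle.coe_eq_coe_iff {x y : ℝ} :
    (x : UnitAddCircle) = y ↔ ∃ k : ℤ, x = y + k := by
  rw [← sub_eq_zero, ← AddCircle.coe_sub, AddCircle.coe_eq_zero_iff]
  refine exists_congr fun k => ?_
  simp only [zsmul_eq_mul, mul_one]
  constructor <;> intro h <;> linarith

theorem UnitAddCircle.dist_coe_le (x y : ℝ) :
    dist (x : UnitAddCircle) y ≤ |x - y| := by
  rw [dist_eq_norm, ← AddCircle.coe_sub, UnitAddCircle.norm_eq]
  simpa using round_le (x - y) 0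

theorem UnitAddCircle.coe_add_int (x : ℝ) (k : ℤ) :
    ((x + k : ℝ) : UnitAddCircle) = x :=
  UnitAddCircle.coe_eq_coe_iff.2 ⟨k, rfl⟩

namespace IsMirrorMotion

variable {a : ℝ → ℝ} {q p : ℕ}

theorem isPeriodicPhase_of_returnMap_eq {β : ℝ} (hβ : returnMap a q p β = β) :
    IsPeriodicPhase a q β := by
  rw [IsPeriodicPhase, returnMap_eq_iff.1 hβ]
  exact_mod_cast UnitAddCircle.coe_add_int β p

theorem coe_iterate_returnMap (ha : IsMirrorMotion a) (m : ℕ) (θ : ℝ) :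
    (((returnMap a q p)^[m] θ : ℝ) : UnitAddCircle) = ((timeAdvance a)^[q * m] θ : ℝ) :=
  UnitAddCircle.coe_eq_coe_iff.2 ⟨-(p * m : ℤ), by rw [ha.iterate_returnMap]; push_cast; ring⟩

theorem inBasin_of_tendsto (ha : IsMirrorMotion a) (hq : 0 < q) {β φ : ℝ}
    (hφ : Tendsto (fun m => (returnMap a q p)^[m] φ) atTop (𝓝 β)) : InBasin a q β φ := by
  have hbound : ∀ n : ℕ, Metric.infDist (((timeAdvance a)^[n] φ : ℝ) : UnitAddCircle)
      (phaseOrbit a q β) ≤ ∑ r ∈ Finset.range q,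
        |(timeAdvance a)^[r] ((returnMap a q p)^[n / q] φ) - (timeAdvance a)^[r] β| := by
    intro n
    have hr := Nat.mod_lt n hq
    have hmem : (((timeAdvance a)^[n % q] β : ℝ) : UnitAddCircle) ∈ phaseOrbit a q β :=
      ⟨n % q, hr, rfl⟩
    have heq : (((timeAdvance a)^[n] φ : ℝ) : UnitAddCircle) =
        ((timeAdvance a)^[n % q] ((returnMap a q p)^[n / q] φ) : ℝ) := by
      have hn := Nat.mod_add_div n q
      generalize n / q = m at hn ⊢
      have := ha.iterate_timeAdvance_add_int (n % q) ((timeAdvance a)^[q * m] φ) (-(p * m : ℤ))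
      rw [← Function.iterate_add_apply, hn] at this
      refine UnitAddCircle.coe_eq_coe_iff.2 ⟨(p * m : ℤ), ?_⟩
      rw [ha.iterate_returnMap]
      push_cast at this ⊢
      rw [sub_eq_add_neg, this]
      ring
    calc _ ≤ dist (((timeAdvance a)^[n] φ : ℝ) : UnitAddCircle)
          ((timeAdvance a)^[n % q] β : ℝ) := Metric.infDist_le_dist_of_mem hmem
      _ ≤ |(timeAdvance a)^[n % q] ((returnMap a q p)^[n / q] φ) - (timeAdvance a)^[n % q] β| := by
          rw [heq]; exact UnitAddCircle.dist_coe_le _ _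
      _ ≤ _ := Finset.single_le_sum (f := fun r =>
          |(timeAdvance a)^[r] ((returnMap a q p)^[n / q] φ) - (timeAdvance a)^[r] β|)
          (fun _ _ => abs_nonneg _) (Finset.mem_range.2 hr)
  refine squeeze_zero (fun _ => Metric.infDist_nonneg) hbound ?_
  rw [← Finset.sum_const_zero (s := Finset.range q)]
  refine tendsto_finsetSum _ fun r _ => ?_
  have h1 := ((ha.continuous_timeAdvance.iterate r).tendsto β).comp
    (hφ.comp (Nat.tendsto_div_const_atTop hq.ne'))
  have h2 := (h1.sub_const ((timeAdvance a)^[r] β)).abs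
  simpa using h2

theorem limit_of_inBasin (ha : IsMirrorMotion a) (hq : 0 < q) {θ φ β : ℝ}
    (hφ : InBasin a q θ φ) (hβ : Tendsto (fun m => (returnMap a q p)^[m] φ) atTop (𝓝 β)) :
    ∃ (i : ℕ) (k : ℤ), β = (timeAdvance a)^[i] θ + k := by
  have h1 : Tendsto (fun m : ℕ => Metric.infDist
      (((timeAdvance a)^[q * m] φ : ℝ) : UnitAddCircle) (phaseOrbit a q θ)) atTop (𝓝 0) :=
    hφ.comp (tendsto_id.const_mul_atTop' hq)
  have h2 : Tendsto (fun m : ℕ => Metric.infDist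
      (((timeAdvance a)^[q * m] φ : ℝ) : UnitAddCircle) (phaseOrbit a q θ)) atTop
      (𝓝 (Metric.infDist (β : UnitAddCircle) (phaseOrbit a q θ))) := by
    simp only [← ha.coe_iterate_returnMap (p := p)]
    exact (((Metric.continuous_infDist_pt _).comp (AddCircle.continuous_mk' 1)).tendsto β).comp hβ
  have hfin : (phaseOrbit a q θ).Finite := (finite_Iio q).image _
  have hne : (phaseOrbit a q θ).Nonempty := ⟨_, 0, hq, rfl⟩
  obtain ⟨i, -, hi⟩ := (hfin.isClosed.mem_iff_infDist_zero hne).2 (tendsto_nhds_unique h2 h1)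
  exact ⟨i, UnitAddCircle.coe_eq_coe_iff.1 hi.symm⟩

theorem returnMap_eq_of_hasRotationNumber (ha : IsMirrorMotion a) (hq : 0 < q)
    (hrot : HasRotationNumber (timeAdvance a) ((p : ℝ) / (q : ℝ))) {θ : ℝ}
    (hper : IsPeriodicPhase a q θ) : returnMap a q p θ = θ := by
  obtain ⟨k, hk⟩ := UnitAddCircle.coe_eq_coe_iff.1 hper
  have hit : ∀ m : ℕ, (timeAdvance a)^[q * m] θ = θ + m * k := fun m => by
    induction m with
    | zero => simp
    | succ m ih =>
      have := ha.iterate_timeAdvance_add_int q θ (m * k)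
      push_cast at this
      rw [Nat.mul_succ, add_comm, Function.iterate_add_apply, ih, this, hk]
      push_cast
      ring
  have h1 : Tendsto (fun m : ℕ => ((timeAdvance a)^[q * m] θ - θ) / ((q * m : ℕ) : ℝ)) atTop
      (𝓝 ((p : ℝ) / q)) := (hrot θ).comp (tendsto_id.const_mul_atTop' hq)
  have hq' : (q : ℝ) ≠ 0 := by positivity
  have h2 : Tendsto (fun m : ℕ => ((timeAdvance a)^[q * m] θ - θ) / ((q * m : ℕ) : ℝ)) atTop
      (𝓝 ((k : ℝ) / q)) := by
    refine tendsto_const_nhds.congr' ?_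
    filter_upwards [eventually_gt_atTop 0] with m hm
    have : (m : ℝ) ≠ 0 := by positivity
    rw [hit]
    push_cast
    field_simp
    ring
  have h3 := tendsto_nhds_unique h1 h2
  rw [div_left_inj' hq'] at h3
  rw [returnMap_eq_iff, hk, h3]

theorem pos_of_returnMap_eq (ha : IsMirrorMotion a) (hq : 0 < q) {θ : ℝ}
    (hθ : returnMap a q p θ = θ) : 0 < p := by
  have h1 := ha.lt_iterate_timeAdvance hq θ
  rw [returnMap_eq_iff.1 hθ] at h1
  have : (0 : ℝ) < p := by linarith
  exact_mod_cast this

end IsMirrorMotion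

/-- A continuous function on a segment whose derivative vanishes inside is constant. -/
theorem eq_of_hasDerivAt_zero {f : ℝ → ℝ} {b c : ℝ} (hbc : b ≤ c) (hf : ContinuousOn f (Icc b c))
    (hd : ∀ x ∈ Ioo b c, HasDerivAt f 0 x) : f b = f c := by
  rcases hbc.eq_or_lt with rfl | hlt
  · rfl
  obtain ⟨x, -, hx⟩ := exists_hasDerivAt_eq_slope f (fun _ => 0) hlt hf hd
  rw [eq_comm, div_eq_zero_iff] at hx
  rcases hx with hx | hx <;> linarith

theorem IsMirrorMotion.isOpen_cavityInterior {a : ℝ → ℝ} (ha : IsMirrorMotion a) (t₀ : ℝ) :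
    IsOpen (cavityInterior a t₀) := by
  have := ha.differentiable.continuous
  exact (isOpen_lt continuous_const continuous_fst).inter
    ((isOpen_lt continuous_const continuous_snd).inter
      (isOpen_lt continuous_snd (this.comp continuous_fst)))

namespace CavityField

variable {a : ℝ → ℝ} {t₀ : ℝ}

/-- Inside the cavity the partial derivatives are differentiable, with the mixed derivatives equal
and the pure ones equal by the wave equation. -/
theorem exists_hasFDerivAt (ha : IsMirrorMotion a) (S : CavityField a t₀) {z : ℝ × ℝ}
    (hz : z ∈ cavityInterior a t₀) :
    ∃ T X : ℝ × ℝ →L[ℝ] ℝ, HasFDerivAt (fun z : ℝ × ℝ => S.At z.1 z.2) T z ∧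
      HasFDerivAt (fun z : ℝ × ℝ => S.Ax z.1 z.2) X z ∧
      T (0, 1) = X (1, 0) ∧ T (1, 0) = X (0, 1) := by
  have hopen := ha.isOpen_cavityInterior t₀
  set f : ℝ × ℝ → ℝ := fun z => S.A z.1 z.2 with hf
  have hC : ∀ y ∈ cavityInterior a t₀, ContDiffAt ℝ 2 f y := fun y hy =>
    S.contDiffOn.contDiffAt (hopen.mem_nhds hy)
  have hfd : ∀ y ∈ cavityInterior a t₀, HasFDerivAt f (fderiv ℝ f y) y := fun y hy =>
    ((hC y hy).differentiableAt (by norm_num)).hasFDerivAt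
  have hAt : ∀ y ∈ cavityInterior a t₀, S.At y.1 y.2 = fderiv ℝ f y (1, 0) := fun y hy => by
    have h1 := (hfd y hy).comp_hasDerivAt (f := fun s => (s, y.2)) y.1
      ((hasDerivAt_id y.1).prodMk (hasDerivAt_const _ _))
    exact (S.hasDerivAt_t y.1 y.2 hy).unique h1
  have hAx : ∀ y ∈ cavityInterior a t₀, S.Ax y.1 y.2 = fderiv ℝ f y (0, 1) := fun y hy => by
    have h1 := (hfd y hy).comp_hasDerivAt (f := fun s => (y.1, s)) y.2
      ((hasDerivAt_const _ _).prodMk (hasDerivAt_id y.2))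
    exact (S.hasDerivAt_x y.1 y.2 hy).unique h1
  have hd2 : HasFDerivAt (fderiv ℝ f) (fderiv ℝ (fderiv ℝ f) z) z :=
    (((hC z hz).fderiv_right (m := 1) (by norm_num)).differentiableAt one_ne_zero).hasFDerivAt
  have hsymm : IsSymmSndFDerivAt ℝ f z := (hC z hz).isSymmSndFDerivAt (by simp)
  have hT := ((ContinuousLinearMap.apply ℝ ℝ ((1, 0) : ℝ × ℝ)).hasFDerivAt.comp z hd2)
    |>.congr_of_eventuallyEq (f₁ := fun z : ℝ × ℝ => S.At z.1 z.2)
      (by filter_upwards [hopen.mem_nhds hz] with y hy using hAt y hy)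
  have hX := ((ContinuousLinearMap.apply ℝ ℝ ((0, 1) : ℝ × ℝ)).hasFDerivAt.comp z hd2)
    |>.congr_of_eventuallyEq (f₁ := fun z : ℝ × ℝ => S.Ax z.1 z.2)
      (by filter_upwards [hopen.mem_nhds hz] with y hy using hAx y hy)
  refine ⟨_, _, hT, hX, hsymm _ _, ?_⟩
  have hw := S.wave z.1 z.2 hz
  have h1 := hT.comp_hasDerivAt (f := fun s => (s, z.2)) z.1
    ((hasDerivAt_id z.1).prodMk (hasDerivAt_const _ _))
  have h2 := hX.comp_hasDerivAt (f := fun s => (z.1, s)) z.2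
    ((hasDerivAt_const _ _).prodMk (hasDerivAt_id z.2))
  have h3 := h1.deriv
  have h4 := h2.deriv
  simp only [Function.comp_def] at h3 h4
  rw [h3, h4] at hw
  exact sub_eq_zero.1 hw

/-- The part of the field that moves to the right. -/
def right (S : CavityField a t₀) (t x : ℝ) : ℝ := S.At t x - S.Ax t x

/-- The part of the field that moves to the left. -/
def left (S : CavityField a t₀) (t x : ℝ) : ℝ := S.At t x + S.Ax t x

theorem continuousOn_right (S : CavityField a t₀) :
    ContinuousOn (fun z : ℝ × ℝ => S.right z.1 z.2) (cavityClosure a t₀) :=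
  S.continuousOn_At.sub S.continuousOn_Ax

theorem continuousOn_left (S : CavityField a t₀) :
    ContinuousOn (fun z : ℝ × ℝ => S.left z.1 z.2) (cavityClosure a t₀) :=
  S.continuousOn_At.add S.continuousOn_Ax

/-- The right-moving part of the field at the moving mirror. -/
def trace (S : CavityField a t₀) (θ : ℝ) : ℝ := S.right θ (a θ)

theorem continuousOn_trace (ha : IsMirrorMotion a) (S : CavityField a t₀) :
    ContinuousOn S.trace (Ici t₀) := by
  refine S.continuousOn_right.comp (f := fun θ => (θ, a θ))
    (continuous_id.prodMk ha.differentiable.continuous).continuousOn fun θ hθ => ?_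
  exact ⟨hθ, (ha.pos θ).le, le_rfl⟩

/-- The right-moving part is transported along characteristics to the moving mirror. -/
theorem right_eq_trace (ha : IsMirrorMotion a) (S : CavityField a t₀) {t x : ℝ}
    (h : (t, x) ∈ cavityClosure a t₀) : S.right t x = S.trace (hitTime a (t - x)) := by
  obtain ⟨ht, hx, hxa⟩ := h
  simp only at ht hx hxa
  set T := hitTime a (t - x) with hT
  have hTe : T - a T = t - x := ha.hitTime_sub _
  have htT : t ≤ T := by
    rw [← ha.strictMono_sub.le_iff_le]
    simp only [hTe]
    linarith
  have hle : ∀ σ ≤ T, σ - a σ ≤ t - x := fun σ hσ => hTe ▸ ha.strictMono_sub.monotone hσ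
  have hlt : ∀ σ < T, σ - a σ < t - x := fun σ hσ => hTe ▸ ha.strictMono_sub hσ
  have key := eq_of_hasDerivAt_zero (f := fun σ => S.right σ (x + (σ - t))) htT
    (S.continuousOn_right.comp (f := fun σ => (σ, x + (σ - t)))
      (by fun_prop) fun σ hσ => ⟨ht.trans hσ.1, by linarith [hσ.1], by
        have := hle σ hσ.2; simp only; linarith⟩)
    (fun σ hσ => by
      have hmem : (σ, x + (σ - t)) ∈ cavityInterior a t₀ :=
        ⟨ht.trans_lt hσ.1, by simp only; linarith [hσ.1], by
          have := hlt σ hσ.2; simp only; linarith⟩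
      obtain ⟨U, V, hU, hV, h1, h2⟩ := S.exists_hasFDerivAt ha hmem
      have hc : HasDerivAt (fun σ : ℝ => (σ, x + (σ - t))) ((1, 1) : ℝ × ℝ) σ :=
        (hasDerivAt_id σ).prodMk (((hasDerivAt_id σ).sub_const t).const_add x)
      have hd := (hU.sub hV).comp_hasDerivAt σ hc
      refine hd.congr_deriv ?_
      have : ((1, 1) : ℝ × ℝ) = (1, 0) + (0, 1) := by simp
      rw [this, map_add]
      simp only [sub_apply, h1, h2]
      ring)
  simp only [sub_self, add_zero] at key
  rw [key, trace]
  congr 1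
  linarith

/-- The left-moving part is transported along characteristics to the mirror at rest. -/
theorem left_eq_left_zero (ha : IsMirrorMotion a) (S : CavityField a t₀) {t x : ℝ}
    (h : (t, x) ∈ cavityClosure a t₀) : S.left t x = S.left (t + x) 0 := by
  obtain ⟨ht, hx, hxa⟩ := h
  simp only at ht hx hxa
  have hle : ∀ σ, t ≤ σ → t + a t ≤ σ + a σ := fun σ hσ => ha.strictMono_add.monotone hσ
  have hlt : ∀ σ, t < σ → t + a t < σ + a σ := fun σ hσ => ha.strictMono_add hσ
  have key := eq_of_hasDerivAt_zero (f := fun σ => S.left σ (x - (σ - t)))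
    (show t ≤ t + x by linarith)
    (S.continuousOn_left.comp (f := fun σ => (σ, x - (σ - t)))
      (by fun_prop) fun σ hσ => ⟨ht.trans hσ.1, by simp only; linarith [hσ.2], by
        have := hle σ hσ.1; simp only; linarith⟩)
    (fun σ hσ => by
      have hmem : (σ, x - (σ - t)) ∈ cavityInterior a t₀ :=
        ⟨ht.trans_lt hσ.1, by simp only; linarith [hσ.2], by
          have := hlt σ hσ.1; simp only; linarith⟩
      obtain ⟨U, V, hU, hV, h1, h2⟩ := S.exists_hasFDerivAt ha hmem
      have hc : HasDerivAt (fun σ : ℝ => (σ, x - (σ - t))) ((1, -1) : ℝ × ℝ) σ :=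
        (hasDerivAt_id σ).prodMk (((hasDerivAt_id σ).sub_const t).const_sub x)
      have hd := (hU.add hV).comp_hasDerivAt σ hc
      refine hd.congr_deriv ?_
      have : ((1, -1) : ℝ × ℝ) = (1, 0) - (0, 1) := by simp
      rw [this, map_sub]
      simp only [add_apply, h1, h2]
      ring)
  simp only [sub_self, sub_zero] at key
  rw [key]
  congr 1
  linarith

/-- Two continuous functions on `[t₀, ∞)` that agree after `t₀` agree at `t₀`. -/
theorem _root_.eq_of_eq_of_lt {f g : ℝ → ℝ} {t₀ : ℝ} (hf : ContinuousOn f (Ici t₀))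
    (hg : ContinuousOn g (Ici t₀)) (h : ∀ t, t₀ < t → f t = g t) {t : ℝ} (ht : t₀ ≤ t) :
    f t = g t := by
  rcases ht.eq_or_lt with rfl | ht
  · have hf' := (hf t₀ self_mem_Ici).mono_left (nhdsWithin_mono _ Ioi_subset_Ici_self)
    have hg' := (hg t₀ self_mem_Ici).mono_left (nhdsWithin_mono _ Ioi_subset_Ici_self)
    refine tendsto_nhds_unique (hf'.congr' ?_) hg'
    filter_upwards [self_mem_nhdsWithin] with t ht using h t ht
  · exact h t ht

theorem At_zero (ha : IsMirrorMotion a) (S : CavityField a t₀) {t : ℝ} (ht : t₀ ≤ t) :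
    S.At t 0 = 0 :=
  eq_of_eq_of_lt (f := fun t => S.At t 0) (g := fun _ => 0)
    (S.continuousOn_At.comp (f := fun t : ℝ => (t, (0 : ℝ))) (by fun_prop)
      fun s hs => ⟨hs, le_rfl, (ha.pos s).le⟩)
    continuousOn_const S.stationary_mirror ht

/-- The left-moving part is what the mirror at rest reflects towards the moving mirror. -/
theorem left_eq_trace (ha : IsMirrorMotion a) (S : CavityField a t₀) {t x : ℝ}
    (h : (t, x) ∈ cavityClosure a t₀) : S.left t x = -S.trace (hitTime a (t + x)) := by
  have ht : t₀ ≤ t + x := add_zero t₀ ▸ add_le_add h.1 h.2.1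
  have h1 := S.right_eq_trace ha (t := t + x) (x := 0) ⟨ht, le_rfl, (ha.pos _).le⟩
  rw [S.left_eq_left_zero ha h, left]
  rw [sub_zero, right] at h1
  rw [← h1, S.At_zero ha ht]
  ring

/-- Reflection from the moving mirror. -/
theorem trace_timeAdvance (ha : IsMirrorMotion a) (S : CavityField a t₀) {t : ℝ} (ht : t₀ ≤ t) :
    S.trace (timeAdvance a t) = dopplerFactor a t * S.trace t := by
  have hmaps : MapsTo (fun t => (t, a t)) (Ici t₀) (cavityClosure a t₀) := fun s hs =>
    ⟨hs, (ha.pos s).le, le_rfl⟩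
  have hcont : ContinuousOn (fun t => (t, a t)) (Ici t₀) :=
    (continuous_id.prodMk ha.differentiable.continuous).continuousOn
  have hm : S.At t (a t) + deriv a t * S.Ax t (a t) = 0 :=
    eq_of_eq_of_lt (f := fun t => S.At t (a t) + deriv a t * S.Ax t (a t)) (g := fun _ => 0)
      ((S.continuousOn_At.comp hcont hmaps).add
        (ha.continuous_deriv.continuousOn.mul (S.continuousOn_Ax.comp hcont hmaps)))
      continuousOn_const S.moving_mirror ht
  have hl := S.left_eq_trace ha (hmaps ht)
  rw [← timeAdvance, left] at hl
  have hr : S.trace t = S.At t (a t) - S.Ax t (a t) := rfl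
  rw [dopplerFactor, div_mul_eq_mul_div, eq_div_iff (ha.one_add_pos t).ne', hr]
  linear_combination (1 + deriv a t) * hl - 2 * hm

/-- The energy density on the moving mirror, per unit of reflection time. -/
noncomputable def flux (S : CavityField a t₀) (θ : ℝ) : ℝ := S.trace θ ^ 2 * (1 - deriv a θ)

theorem flux_nonneg (ha : IsMirrorMotion a) (S : CavityField a t₀) (θ : ℝ) : 0 ≤ S.flux θ :=
  mul_nonneg (sq_nonneg _) (ha.one_sub_pos θ).le

theorem continuousOn_flux (ha : IsMirrorMotion a) (S : CavityField a t₀) :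
    ContinuousOn S.flux (Ici t₀) :=
  ((S.continuousOn_trace ha).pow 2).mul
    (continuous_const.sub ha.continuous_deriv).continuousOn

theorem flux_timeAdvance (ha : IsMirrorMotion a) (S : CavityField a t₀) {t : ℝ} (ht : t₀ ≤ t) :
    S.flux (timeAdvance a t) * deriv (timeAdvance a) t = dopplerFactor a t * S.flux t := by
  rw [flux, flux, S.trace_timeAdvance ha ht, (ha.hasDerivAt_timeAdvance t).deriv, dopplerFactor]
  have h1 := (ha.one_sub_pos (timeAdvance a t)).ne'
  have h2 := (ha.one_add_pos t).ne'
  field_simp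

theorem flux_iterate (ha : IsMirrorMotion a) (S : CavityField a t₀) {t : ℝ} (ht : t₀ ≤ t) (n : ℕ) :
    S.flux ((timeAdvance a)^[n] t) * deriv (timeAdvance a)^[n] t = totalDoppler a n t * S.flux t := by
  induction n with
  | zero => simp [totalDoppler]
  | succ n ih =>
    have hn : t₀ ≤ (timeAdvance a)^[n] t :=
      ht.trans (Function.id_le_iterate_of_id_le (fun x => (ha.lt_timeAdvance x).le) n t)
    have h1 := S.flux_timeAdvance ha hn
    rw [Function.iterate_succ', deriv_comp _ (ha.hasDerivAt_timeAdvance _).differentiableAt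
      (ha.hasDerivAt_iterate_timeAdvance n t).differentiableAt, Function.comp_apply,
      totalDoppler, Finset.prod_range_succ, ← totalDoppler, ← mul_assoc, h1]
    linear_combination (dopplerFactor a ((timeAdvance a)^[n] t)) * ih

/-- The energy is the flux over one round trip. -/
theorem energy_eq (ha : IsMirrorMotion a) (S : CavityField a t₀) {t : ℝ} (ht : t₀ ≤ t) :
    S.energy t = 1 / (16 * Real.pi) * ∫ θ in t..timeAdvance a t, S.flux θ := by
  have hat := ha.pos t
  have hc : ContinuousOn (fun s => S.trace (hitTime a s) ^ 2) (Ici (t - a t)) := by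
    refine ((S.continuousOn_trace ha).comp ha.continuous_hitTime.continuousOn fun s hs => ?_).pow 2
    have := ha.strictMono_hitTime.monotone hs
    rw [ha.hitTime_of_sub] at this
    exact ht.trans this
  have hint : ∀ {b c : ℝ}, t - a t ≤ b → t - a t ≤ c →
      IntervalIntegrable (fun s => S.trace (hitTime a s) ^ 2) MeasureTheory.volume b c :=
    fun hb hc' => (hc.mono fun s hs => (le_min hb hc').trans hs.1).intervalIntegrable
  have h1 : ∫ x in (0 : ℝ)..a t, (S.At t x ^ 2 + S.Ax t x ^ 2) =
      ∫ x in (0 : ℝ)..a t, (1 / 2 * S.trace (hitTime a (t - x)) ^ 2 +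
        1 / 2 * S.trace (hitTime a (t + x)) ^ 2) := by
    refine intervalIntegral.integral_congr fun x hx => ?_
    rw [uIcc_of_le hat.le] at hx
    have hmem : (t, x) ∈ cavityClosure a t₀ := ⟨ht, hx.1, hx.2⟩
    have hr := S.right_eq_trace ha hmem
    have hl := S.left_eq_trace ha hmem
    rw [right] at hr
    rw [left] at hl
    have hl' : S.trace (hitTime a (t + x)) = -(S.At t x + S.Ax t x) := by linarith
    rw [← hr, hl']
    ring
  have h2 : ∫ x in (0 : ℝ)..a t, 1 / 2 * S.trace (hitTime a (t - x)) ^ 2 =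
      1 / 2 * ∫ s in (t - a t)..t, S.trace (hitTime a s) ^ 2 := by
    rw [intervalIntegral.integral_const_mul,
      intervalIntegral.integral_comp_sub_left (fun s => S.trace (hitTime a s) ^ 2), sub_zero]
  have h3 : ∫ x in (0 : ℝ)..a t, 1 / 2 * S.trace (hitTime a (t + x)) ^ 2 =
      1 / 2 * ∫ s in t..(t + a t), S.trace (hitTime a s) ^ 2 := by
    rw [intervalIntegral.integral_const_mul,
      intervalIntegral.integral_comp_add_left (fun s => S.trace (hitTime a s) ^ 2), add_zero]
  have h4 : ∫ θ in t..timeAdvance a t, S.flux θ =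
      ∫ s in (t - a t)..(t + a t), S.trace (hitTime a s) ^ 2 := by
    have := intervalIntegral.integral_comp_mul_deriv'' (a := t) (b := timeAdvance a t)
      (f := fun θ => θ - a θ) (f' := fun θ => 1 - deriv a θ)
      (g := fun s => S.trace (hitTime a s) ^ 2)
      (fun x _ => (ha.hasDerivAt_sub x).continuousAt.continuousWithinAt)
      (fun x _ => (ha.hasDerivAt_sub x).hasDerivWithinAt)
      (continuous_const.sub ha.continuous_deriv).continuousOn
      (hc.mono (by
        rintro _ ⟨θ, hθ, rfl⟩
        rw [uIcc_of_le (ha.lt_timeAdvance t).le] at hθ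
        exact ha.strictMono_sub.monotone hθ.1))
    simp only [Function.comp, ha.hitTime_of_sub, ha.timeAdvance_sub] at this
    exact this
  have i1 : IntervalIntegrable (fun x => 1 / 2 * S.trace (hitTime a (t - x)) ^ 2)
      MeasureTheory.volume 0 (a t) := by
    have := (hint (b := t) (c := t - a t) (by linarith) le_rfl).comp_sub_left t
    simpa using this.const_mul (1 / 2)
  have i2 : IntervalIntegrable (fun x => 1 / 2 * S.trace (hitTime a (t + x)) ^ 2)
      MeasureTheory.volume 0 (a t) := by
    have := (hint (b := t) (c := t + a t) (by linarith) (by linarith)).comp_add_left t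
    simpa using this.const_mul (1 / 2)
  rw [energy, h1, intervalIntegral.integral_add i1 i2, h2, h3, h4,
    ← intervalIntegral.integral_add_adjacent_intervals (hint (b := t - a t) (c := t) le_rfl
      (by linarith)) (hint (b := t) (c := t + a t) (by linarith) (by linarith))]
  field_simp
  ring

/-- The first reflections of the initial field are the times in `[t₀, G t₀]` at which the flux
does not vanish. -/
theorem firstReflection_iff (ha : IsMirrorMotion a) (S : CavityField a t₀) {φ : ℝ} :
    S.FirstReflection φ ↔ φ ∈ Icc t₀ (timeAdvance a t₀) ∧ S.trace φ ≠ 0 := by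
  have hat := ha.pos t₀
  have hmem : ∀ {x}, x ∈ Icc 0 (a t₀) → (t₀, x) ∈ cavityClosure a t₀ := fun hx =>
    ⟨le_rfl, hx.1, hx.2⟩
  constructor
  · have hIcc : ∀ s, t₀ - a t₀ ≤ s → s ≤ t₀ + a t₀ →
        hitTime a s ∈ Icc t₀ (timeAdvance a t₀) := fun s h1 h2 => by
      refine ⟨?_, ha.strictMono_hitTime.monotone h2⟩
      have := ha.strictMono_hitTime.monotone h1
      rwa [ha.hitTime_of_sub] at this
    rintro ⟨x, hx, ⟨h, rfl⟩ | ⟨h, rfl⟩⟩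
    · refine ⟨hIcc _ (by linarith [hx.2]) (by linarith [hx.1]), ?_⟩
      rwa [← S.right_eq_trace ha (hmem hx)]
    · refine ⟨hIcc _ (by linarith [hx.1]) (by linarith [hx.2]), ?_⟩
      rwa [← neg_ne_zero, ← S.left_eq_trace ha (hmem hx)]
  · rintro ⟨⟨h1, h2⟩, hφ⟩
    have h3 := ha.strictMono_sub.monotone h1
    have h4 := ha.strictMono_sub.monotone h2
    simp only [ha.timeAdvance_sub] at h3 h4
    rcases le_total (φ - a φ) t₀ with h | h
    · have hx : t₀ - (φ - a φ) ∈ Icc 0 (a t₀) := ⟨by linarith, by linarith⟩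
      have he : hitTime a (t₀ - (t₀ - (φ - a φ))) = φ := by
        rw [sub_sub_cancel, ha.hitTime_of_sub]
      refine ⟨_, hx, Or.inl ⟨?_, he.symm⟩⟩
      rw [← right, S.right_eq_trace ha (hmem hx), he]
      exact hφ
    · have hx : φ - a φ - t₀ ∈ Icc 0 (a t₀) := ⟨by linarith, by linarith⟩
      have he : hitTime a (t₀ + (φ - a φ - t₀)) = φ := by
        rw [add_sub_cancel, ha.hitTime_of_sub]
      refine ⟨_, hx, Or.inr ⟨?_, he.symm⟩⟩
      rw [← left, S.left_eq_trace ha (hmem hx), he]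
      exact neg_ne_zero.2 hφ

end CavityField

namespace IsMirrorMotion

variable {a : ℝ → ℝ} {q p : ℕ}

theorem le_iterate_timeAdvance (ha : IsMirrorMotion a) (n : ℕ) (θ : ℝ) :
    θ ≤ (timeAdvance a)^[n] θ :=
  Function.id_le_iterate_of_id_le (fun x => (ha.lt_timeAdvance x).le) n θ

/-- Doppler factors are bounded. -/
theorem exists_dopplerFactor_bounds (ha : IsMirrorMotion a) :
    ∃ M, 1 ≤ M ∧ ∀ θ, dopplerFactor a θ ≤ M ∧ 1 ≤ M * dopplerFactor a θ := by
  have hc := ha.continuous_dopplerFactor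
  have hper : Function.Periodic (dopplerFactor a) 1 := fun x => by
    simpa using ha.dopplerFactor_add_int x 1
  obtain ⟨M₁, hM₁⟩ := (isCompact_Icc (a := (0 : ℝ)) (b := 1)).exists_bound_of_continuousOn
    hc.continuousOn
  obtain ⟨M₂, hM₂⟩ := (isCompact_Icc (a := (0 : ℝ)) (b := 1)).exists_bound_of_continuousOn
    (hc.inv₀ fun θ => (ha.dopplerFactor_pos θ).ne').continuousOn
  refine ⟨max 1 (max M₁ M₂), le_max_left _ _, fun θ => ?_⟩
  obtain ⟨y, hy, hθ⟩ := hper.exists_mem_Ico₀ one_pos θ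
  have hpos := ha.dopplerFactor_pos y
  have h1 := (le_abs_self _).trans (hM₁ y (Ico_subset_Icc_self hy))
  have h2 := (le_abs_self _).trans (hM₂ y (Ico_subset_Icc_self hy))
  rw [hθ]
  refine ⟨h1.trans ((le_max_left _ _).trans (le_max_right _ _)), ?_⟩
  calc 1 = (dopplerFactor a y)⁻¹ * dopplerFactor a y := (inv_mul_cancel₀ hpos.ne').symm
    _ ≤ _ := mul_le_mul_of_nonneg_right
      (h2.trans ((le_max_right _ _).trans (le_max_right _ _))) hpos.le

theorem exists_one_sub_bound (ha : IsMirrorMotion a) :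
    ∃ w, 0 < w ∧ ∀ t, w ≤ 1 - deriv a t ∧ 1 - deriv a t ≤ 2 := by
  obtain ⟨w, hw, h⟩ := (isCompact_Icc (a := (0 : ℝ)) (b := 1)).exists_forall_le'
    (f := fun t => 1 - deriv a t) (continuous_const.sub ha.continuous_deriv).continuousOn
    (a := 0) (fun t _ => ha.one_sub_pos t)
  refine ⟨w, hw, fun t => ⟨?_, by linarith [ha.one_add_pos t]⟩⟩
  obtain ⟨y, hy, ht⟩ := ha.periodic_deriv.exists_mem_Ico₀ one_pos t
  rw [ht]
  exact h y (Ico_subset_Icc_self hy)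

theorem continuous_totalDoppler (ha : IsMirrorMotion a) (n : ℕ) :
    Continuous (totalDoppler a n) :=
  continuous_finsetProd _ fun i _ =>
    ha.continuous_dopplerFactor.comp (ha.continuous_timeAdvance.iterate i)

/-- The total Doppler factor over `q * m` reflections is comparable to the inverse of the
derivative of the `m`-th iterate of the return map. -/
theorem exists_totalDoppler_bounds (ha : IsMirrorMotion a) {ℓ : ℝ → ℝ} {L : ℝ}
    (h : IsCircleLift (returnMap a q p) ℓ L) :
    ∃ M, 0 < M ∧ ∀ (m : ℕ) (θ : ℝ),
      totalDoppler a (q * m) θ ≤ M * Real.exp (-birkhoffSum (returnMap a q p) ℓ m θ) ∧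
      Real.exp (-birkhoffSum (returnMap a q p) ℓ m θ) ≤ M * totalDoppler a (q * m) θ := by
  obtain ⟨w, hw, hb⟩ := ha.exists_one_sub_bound
  refine ⟨2 / w, by positivity, fun m θ => ?_⟩
  have key := ha.totalDoppler_mul_exp h m θ
  obtain ⟨h1, h2⟩ := hb θ
  obtain ⟨h3, h4⟩ := hb ((timeAdvance a)^[q * m] θ)
  have hD := ha.totalDoppler_pos (q * m) θ
  have hE := Real.exp_pos (-birkhoffSum (returnMap a q p) ℓ m θ)
  constructor
  · rw [div_mul_eq_mul_div, le_div_iff₀ hw]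
    nlinarith [mul_le_mul_of_nonneg_left h3 hD.le, mul_le_mul_of_nonneg_right h2 hE.le]
  · rw [div_mul_eq_mul_div, le_div_iff₀ hw]
    nlinarith [mul_le_mul_of_nonneg_left h4 hD.le, mul_le_mul_of_nonneg_right h1 hE.le]

/-- Every time lies in one of the intervals cut out by the orbit of `t₀` under the `q`-th iterate
of the time advance map, and the mean length of these intervals is `p`. -/
theorem exists_iterate_le_lt (ha : IsMirrorMotion a) (hq : 0 < q) {z : ℝ}
    (hz : returnMap a q p z = z) {t₀ t : ℝ} (ht : t₀ ≤ t) :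
    ∃ m : ℕ, (timeAdvance a)^[q * m] t₀ ≤ t ∧
      t < (timeAdvance a)^[q] ((timeAdvance a)^[q * m] t₀) ∧ |t - p * m| ≤ |t₀| + p + 1 := by
  obtain ⟨ℓ, L, h⟩ := ha.exists_isCircleLift_returnMap q p
  have hdist : ∀ m : ℕ, |(timeAdvance a)^[q * m] t₀ - p * m - t₀| ≤ 1 := fun m => by
    rw [← ha.iterate_returnMap]
    exact h.abs_iterate_sub_le hz t₀ m
  have hp : (1 : ℝ) ≤ p := by exact_mod_cast ha.pos_of_returnMap_eq hq hz
  have hex : ∃ m : ℕ, t < (timeAdvance a)^[q * m] t₀ := by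
    obtain ⟨m, hm⟩ := exists_nat_gt (t - t₀ + 1)
    refine ⟨m, ?_⟩
    have h1 := (abs_le.1 (hdist m)).1
    have h2 : (m : ℝ) ≤ p * m := le_mul_of_one_le_left (Nat.cast_nonneg m) hp
    linarith
  classical
  obtain ⟨m, hm⟩ : ∃ m, Nat.find hex = m + 1 := Nat.exists_eq_succ_of_ne_zero fun h0 => by
    have := Nat.find_spec hex
    rw [h0] at this
    simp only [mul_zero, Function.iterate_zero, id] at this
    linarith
  have h1 : (timeAdvance a)^[q * m] t₀ ≤ t := not_lt.1 (Nat.find_min hex (by omega))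
  have h2 : t < (timeAdvance a)^[q * (m + 1)] t₀ := hm ▸ Nat.find_spec hex
  refine ⟨m, h1, ?_, ?_⟩
  · rwa [← Function.iterate_add_apply, add_comm, ← Nat.mul_succ]
  · have h3 := (abs_le.1 (hdist m)).1
    have h4 := (abs_le.1 (hdist (m + 1))).2
    push_cast at h4
    rw [abs_le]
    constructor <;> linarith [neg_abs_le t₀, le_abs_self t₀]

end IsMirrorMotion

namespace CavityField

variable {a : ℝ → ℝ} {t₀ : ℝ}

theorem intervalIntegrable_flux (ha : IsMirrorMotion a) (S : CavityField a t₀) {b c : ℝ}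
    (hb : t₀ ≤ b) (hc : t₀ ≤ c) : IntervalIntegrable S.flux MeasureTheory.volume b c :=
  ((S.continuousOn_flux ha).mono fun _ hs => (le_min hb hc).trans hs.1).intervalIntegrable

theorem continuousOn_totalDoppler_mul_flux (ha : IsMirrorMotion a) (S : CavityField a t₀) (n : ℕ) :
    ContinuousOn (fun θ => totalDoppler a n θ * S.flux θ) (Ici t₀) :=
  (ha.continuous_totalDoppler n).continuousOn.mul (S.continuousOn_flux ha)

theorem intervalIntegrable_totalDoppler_mul_flux (ha : IsMirrorMotion a) (S : CavityField a t₀)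
    (n : ℕ) {b c : ℝ} (hb : t₀ ≤ b) (hc : t₀ ≤ c) :
    IntervalIntegrable (fun θ => totalDoppler a n θ * S.flux θ) MeasureTheory.volume b c :=
  ((S.continuousOn_totalDoppler_mul_flux ha n).mono
    fun _ hs => (le_min hb hc).trans hs.1).intervalIntegrable

/-- The flux through the images of a time interval. -/
theorem integral_flux_iterate (ha : IsMirrorMotion a) (S : CavityField a t₀) (n : ℕ) {b c : ℝ}
    (hb : t₀ ≤ b) (hc : t₀ ≤ c) :
    ∫ θ in (timeAdvance a)^[n] b..(timeAdvance a)^[n] c, S.flux θ =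
      ∫ θ in b..c, totalDoppler a n θ * S.flux θ := by
  have hu : ∀ θ ∈ uIcc b c, t₀ ≤ θ := fun θ hθ => (le_min hb hc).trans hθ.1
  have hd : deriv (timeAdvance a)^[n] = fun θ => (1 - deriv a θ) /
      ((1 - deriv a ((timeAdvance a)^[n] θ)) * totalDoppler a n θ) :=
    funext fun θ => (ha.hasDerivAt_iterate_timeAdvance n θ).deriv
  have hdc : Continuous (deriv (timeAdvance a)^[n]) := by
    rw [hd]
    refine (continuous_const.sub ha.continuous_deriv).div ((continuous_const.sub
      (ha.continuous_deriv.comp (ha.continuous_timeAdvance.iterate n))).mul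
      (ha.continuous_totalDoppler n)) fun θ => ?_
    exact (mul_pos (ha.one_sub_pos _) (ha.totalDoppler_pos _ _)).ne'
  rw [← intervalIntegral.integral_comp_mul_deriv'' (f' := deriv (timeAdvance a)^[n])
    (ha.continuous_timeAdvance.iterate n).continuousOn
    (fun θ _ => (ha.hasDerivAt_iterate_timeAdvance n θ).differentiableAt.hasDerivAt.hasDerivWithinAt)
    hdc.continuousOn ((S.continuousOn_flux ha).mono ?_)]
  · exact intervalIntegral.integral_congr fun θ hθ => S.flux_iterate ha (hu θ hθ) n
  · rintro _ ⟨θ, hθ, rfl⟩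
    exact (hu θ hθ).trans (ha.le_iterate_timeAdvance n θ)

theorem energy_iterate (ha : IsMirrorMotion a) (S : CavityField a t₀) (n : ℕ) :
    S.energy ((timeAdvance a)^[n] t₀) =
      1 / (16 * Real.pi) * ∫ θ in t₀..timeAdvance a t₀, totalDoppler a n θ * S.flux θ := by
  rw [S.energy_eq ha (ha.le_iterate_timeAdvance n t₀), ← S.integral_flux_iterate ha n le_rfl
    (ha.lt_timeAdvance t₀).le, ← Function.iterate_succ_apply' (timeAdvance a),
    Function.iterate_succ_apply]

theorem energy_nonneg (ha : IsMirrorMotion a) (S : CavityField a t₀) {t : ℝ} (ht : t₀ ≤ t) :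
    0 ≤ S.energy t := by
  rw [S.energy_eq ha ht]
  exact mul_nonneg (by positivity) (intervalIntegral.integral_nonneg (ha.lt_timeAdvance t).le
    fun θ _ => S.flux_nonneg ha θ)

/-- Energies within one round trip are comparable. -/
theorem energy_compare (ha : IsMirrorMotion a) (S : CavityField a t₀) {M : ℝ} (hM1 : 1 ≤ M)
    (hM : ∀ θ, dopplerFactor a θ ≤ M ∧ 1 ≤ M * dopplerFactor a θ) {t s : ℝ} (ht : t₀ ≤ t)
    (hts : t ≤ s) (hs : s ≤ timeAdvance a t) :
    S.energy s ≤ M * S.energy t ∧ S.energy t ≤ M * S.energy s := by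
  have hs₀ := ht.trans hts
  have hGt := hs₀.trans hs
  have hGs := hs₀.trans (ha.lt_timeAdvance s).le
  have hD : totalDoppler a 1 = dopplerFactor a := by
    ext θ; simp [totalDoppler]
  have h1 := intervalIntegral.integral_add_adjacent_intervals
    (S.intervalIntegrable_flux ha ht hs₀) (S.intervalIntegrable_flux ha hs₀ hGt)
  have h2 := intervalIntegral.integral_add_adjacent_intervals
    (S.intervalIntegrable_flux ha hs₀ hGt) (S.intervalIntegrable_flux ha hGt hGs)
  have h3 := S.integral_flux_iterate ha 1 ht hs₀
  have hi := S.intervalIntegrable_totalDoppler_mul_flux ha 1 ht hs₀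
  rw [hD] at h3 hi
  simp only [Function.iterate_one] at h3
  have hf := S.intervalIntegrable_flux ha ht hs₀
  have h4 : ∫ θ in t..s, dopplerFactor a θ * S.flux θ ≤ M * ∫ θ in t..s, S.flux θ := by
    rw [← intervalIntegral.integral_const_mul]
    exact intervalIntegral.integral_mono_on hts hi (hf.const_mul M)
      fun θ _ => mul_le_mul_of_nonneg_right (hM θ).1 (S.flux_nonneg ha θ)
  have h5 : ∫ θ in t..s, S.flux θ ≤ M * ∫ θ in t..s, dopplerFactor a θ * S.flux θ := by
    rw [← intervalIntegral.integral_const_mul]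
    refine intervalIntegral.integral_mono_on hts hf (hi.const_mul M) fun θ _ => ?_
    rw [← mul_assoc]
    exact le_mul_of_one_le_left (S.flux_nonneg ha θ) (hM θ).2
  have h6 : 0 ≤ ∫ θ in s..timeAdvance a t, S.flux θ :=
    intervalIntegral.integral_nonneg hs fun θ _ => S.flux_nonneg ha θ
  have h7 := le_mul_of_one_le_left h6 hM1
  have hκ : 0 ≤ 1 / (16 * Real.pi) := by positivity
  rw [S.energy_eq ha ht, S.energy_eq ha hs₀, ← h1, ← h2, h3, mul_left_comm, mul_left_comm M]
  constructor <;> refine mul_le_mul_of_nonneg_left ?_ hκ <;> rw [mul_add] <;> linarith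

theorem energy_compare_iterate (ha : IsMirrorMotion a) (S : CavityField a t₀) {M : ℝ} (hM1 : 1 ≤ M)
    (hM : ∀ θ, dopplerFactor a θ ≤ M ∧ 1 ≤ M * dopplerFactor a θ) {t : ℝ} (ht : t₀ ≤ t)
    (k : ℕ) {s : ℝ} (hts : t ≤ s) (hs : s ≤ (timeAdvance a)^[k] t) :
    S.energy s ≤ M ^ k * S.energy t ∧ S.energy t ≤ M ^ k * S.energy s := by
  induction k generalizing s with
  | zero =>
    obtain rfl : t = s := le_antisymm hts hs
    simp
  | succ k ih =>
    have hM0 : 0 ≤ M := zero_le_one.trans hM1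
    have hMk : 0 ≤ M ^ k := pow_nonneg hM0 k
    rw [Function.iterate_succ_apply'] at hs
    have hk := ha.le_iterate_timeAdvance k t
    rcases le_total s ((timeAdvance a)^[k] t) with h | h
    · obtain ⟨h1, h2⟩ := ih hts h
      have hpow := pow_le_pow_right₀ hM1 (Nat.le_succ k)
      exact ⟨h1.trans (mul_le_mul_of_nonneg_right hpow (S.energy_nonneg ha ht)),
        h2.trans (mul_le_mul_of_nonneg_right hpow (S.energy_nonneg ha (ht.trans hts)))⟩
    · obtain ⟨h1, h2⟩ := ih hk le_rfl
      obtain ⟨h3, h4⟩ := S.energy_compare ha hM1 hM (ht.trans hk) h hs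
      constructor
      · calc _ ≤ _ := h3
          _ ≤ _ := mul_le_mul_of_nonneg_left h1 hM0
          _ = _ := by ring
      · calc _ ≤ _ := h2
          _ ≤ _ := mul_le_mul_of_nonneg_left h4 hMk
          _ = _ := by ring

end CavityField

namespace CavityField

variable {a : ℝ → ℝ} {t₀ : ℝ} {q p : ℕ}

/-- Energies at all times are comparable to those along the orbit of `t₀`. -/
theorem exists_energy_compare (ha : IsMirrorMotion a) (S : CavityField a t₀) (hq : 0 < q) {z : ℝ}
    (hz : returnMap a q p z = z) {μ : ℝ} (hμ : 0 < μ) :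
    ∃ K, 0 < K ∧ ∀ t, t₀ ≤ t → ∃ m : ℕ,
      S.energy t ≤ K * S.energy ((timeAdvance a)^[q * m] t₀) ∧
      S.energy ((timeAdvance a)^[q * m] t₀) ≤ K * S.energy t ∧
      Real.exp (μ / p * t) ≤ K * Real.exp (μ * m) ∧
      Real.exp (μ * m) ≤ K * Real.exp (μ / p * t) := by
  obtain ⟨M, hM1, hM⟩ := ha.exists_dopplerFactor_bounds
  have hp : (0 : ℝ) < p := by exact_mod_cast ha.pos_of_returnMap_eq hq hz
  have hM0 : 0 < M := one_pos.trans_le hM1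
  set B := μ / p * (|t₀| + p + 1) with hB
  refine ⟨max (M ^ q) (Real.exp B), lt_max_of_lt_left (by positivity), fun t ht => ?_⟩
  obtain ⟨m, h1, h2, h3⟩ := ha.exists_iterate_le_lt hq hz ht
  have hm := ha.le_iterate_timeAdvance (q * m) t₀
  obtain ⟨h4, h5⟩ := S.energy_compare_iterate ha hM1 hM hm q h1 h2.le
  have h6 : |μ / p * t - μ * m| ≤ B := by
    have : μ / p * t - μ * m = μ / p * (t - p * m) := by field_simp
    rw [this, abs_mul, abs_of_pos (by positivity)]
    exact mul_le_mul_of_nonneg_left h3 (by positivity)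
  obtain ⟨h7, h8⟩ := abs_le.1 h6
  refine ⟨m, h4.trans (mul_le_mul_of_nonneg_right (le_max_left _ _) (S.energy_nonneg ha hm)),
    h5.trans (mul_le_mul_of_nonneg_right (le_max_left _ _) (S.energy_nonneg ha ht)), ?_, ?_⟩
  · refine le_trans ?_ (mul_le_mul_of_nonneg_right (le_max_right _ _) (Real.exp_pos _).le)
    rw [← Real.exp_add]
    exact Real.exp_le_exp.2 (by linarith)
  · refine le_trans ?_ (mul_le_mul_of_nonneg_right (le_max_right _ _) (Real.exp_pos _).le)
    rw [← Real.exp_add]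
    exact Real.exp_le_exp.2 (by linarith)

/-- A non-zero flux in the basin of a stable periodic orbit forces exponential growth. -/
theorem exists_exp_le_energy (ha : IsMirrorMotion a) (S : CavityField a t₀) {ℓ : ℝ → ℝ} {L : ℝ}
    (h : IsCircleLift (returnMap a q p) ℓ L) {β φ μ : ℝ} (hβ : returnMap a q p β = β)
    (hμ : 0 < μ) (hβμ : μ + ℓ β = 0)
    (hφ : Tendsto (fun m => (returnMap a q p)^[m] φ) atTop (𝓝 β))
    (hφm : φ ∈ Icc t₀ (timeAdvance a t₀)) (hne : S.trace φ ≠ 0) :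
    ∃ c, 0 < c ∧ ∀ m : ℕ, c * Real.exp (μ * m) ≤ S.energy ((timeAdvance a)^[q * m] t₀) := by
  obtain ⟨C, hC⟩ := h.birkhoffSum_le_near hβ hμ hβμ hφ
  obtain ⟨M, hM0, hM⟩ := ha.exists_totalDoppler_bounds h
  obtain ⟨δ, hδ, hball⟩ := Metric.nhds_basis_closedBall.mem_iff.1 hC
  have hG := ha.lt_timeAdvance t₀
  set b := max t₀ (φ - δ) with hb
  set c := min (timeAdvance a t₀) (φ + δ) with hc
  have hbt : t₀ ≤ b := le_max_left _ _
  have hbφ : b ≤ φ := max_le hφm.1 (by linarith)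
  have hφc : φ ≤ c := le_min hφm.2 (by linarith)
  have hbc : b < c := max_lt (lt_min hG (by linarith [hφm.1])) (lt_min (by linarith [hφm.2])
    (by linarith))
  have hpos : 0 < ∫ θ in b..c, S.flux θ := by
    refine intervalIntegral.integral_pos hbc
      ((S.continuousOn_flux ha).mono fun θ hθ => hbt.trans hθ.1)
      (fun θ _ => S.flux_nonneg ha θ) ⟨φ, ⟨hbφ, hφc⟩, ?_⟩
    exact mul_pos (by positivity) (ha.one_sub_pos φ)
  refine ⟨1 / (16 * Real.pi) * (M⁻¹ * Real.exp (-C) * ∫ θ in b..c, S.flux θ),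
    by positivity, fun m => ?_⟩
  rw [S.energy_iterate ha, mul_assoc]
  refine mul_le_mul_of_nonneg_left ?_ (by positivity)
  have hle : ∀ θ ∈ Icc b c, M⁻¹ * Real.exp (-C) * Real.exp (μ * m) * S.flux θ ≤
      totalDoppler a (q * m) θ * S.flux θ := fun θ hθ => by
    refine mul_le_mul_of_nonneg_right ?_ (S.flux_nonneg ha θ)
    have h1 : birkhoffSum (returnMap a q p) ℓ m θ ≤ C - μ * m := by
      refine hball ?_ m
      rw [Metric.mem_closedBall, Real.dist_eq, abs_le]
      constructor
      · linarith [hθ.1, le_max_right t₀ (φ - δ)]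
      · linarith [hθ.2, min_le_right (timeAdvance a t₀) (φ + δ)]
    rw [mul_assoc, ← Real.exp_add, inv_mul_le_iff₀ hM0]
    exact (Real.exp_le_exp.2 (by linarith)).trans (hM m θ).2
  calc M⁻¹ * Real.exp (-C) * (∫ θ in b..c, S.flux θ) * Real.exp (μ * m)
      = ∫ θ in b..c, M⁻¹ * Real.exp (-C) * Real.exp (μ * m) * S.flux θ := by
        rw [intervalIntegral.integral_const_mul]; ring
    _ ≤ ∫ θ in b..c, totalDoppler a (q * m) θ * S.flux θ :=
        intervalIntegral.integral_mono_on hbc.le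
          ((S.intervalIntegrable_flux ha hbt (hbt.trans hbc.le)).const_mul _)
          (S.intervalIntegrable_totalDoppler_mul_flux ha _ hbt (hbt.trans hbc.le)) hle
    _ ≤ _ := intervalIntegral.integral_mono_interval hbt hbc.le (min_le_left _ _)
        (Eventually.of_forall fun θ => mul_nonneg (ha.totalDoppler_pos _ _).le (S.flux_nonneg ha θ))
        (S.intervalIntegrable_totalDoppler_mul_flux ha _ le_rfl hG.le)

/-- If every non-zero part of the flux tends to a periodic orbit with derivative at least
`exp (-μ)`, then the energy grows at most with the corresponding rate. -/
theorem exists_energy_le_exp (ha : IsMirrorMotion a) (S : CavityField a t₀) {ℓ : ℝ → ℝ} {L : ℝ}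
    (h : IsCircleLift (returnMap a q p) ℓ L) {z μ : ℝ} (hz : returnMap a q p z = z) (hμ : 0 < μ)
    (hdom : ∀ θ ∈ Icc t₀ (timeAdvance a t₀), S.trace θ ≠ 0 → ∀ β, returnMap a q p β = β →
      Tendsto (fun m => (returnMap a q p)^[m] θ) atTop (𝓝 β) → 0 ≤ μ + ℓ β) :
    ∃ C, 0 < C ∧ ∀ m : ℕ, S.energy ((timeAdvance a)^[q * m] t₀) ≤ C * Real.exp (μ * m) := by
  obtain ⟨C, hC⟩ := h.birkhoffSum_ge hz hμ
  obtain ⟨M, hM0, hM⟩ := ha.exists_totalDoppler_bounds h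
  have hG := ha.lt_timeAdvance t₀
  have hI : 0 ≤ ∫ θ in t₀..timeAdvance a t₀, S.flux θ :=
    intervalIntegral.integral_nonneg hG.le fun θ _ => S.flux_nonneg ha θ
  refine ⟨1 / (16 * Real.pi) * (M * Real.exp C * (∫ θ in t₀..timeAdvance a t₀, S.flux θ) + 1),
    by positivity, fun m => ?_⟩
  rw [S.energy_iterate ha, mul_assoc]
  refine mul_le_mul_of_nonneg_left ?_ (by positivity)
  have hle : ∀ θ ∈ Icc t₀ (timeAdvance a t₀), totalDoppler a (q * m) θ * S.flux θ ≤
      M * Real.exp C * Real.exp (μ * m) * S.flux θ := fun θ hθ => by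
    by_cases hne : S.trace θ = 0
    · simp [flux, hne]
    obtain ⟨β, hβ, hlim⟩ := h.exists_tendsto_iterate hz θ
    have h1 := hC θ β hlim (hdom θ hθ hne β hβ hlim) m
    refine mul_le_mul_of_nonneg_right ((hM m θ).1.trans ?_) (S.flux_nonneg ha θ)
    rw [mul_assoc, ← Real.exp_add]
    exact mul_le_mul_of_nonneg_left (Real.exp_le_exp.2 (by linarith)) hM0.le
  calc _ ≤ ∫ θ in t₀..timeAdvance a t₀, M * Real.exp C * Real.exp (μ * m) * S.flux θ :=
        intervalIntegral.integral_mono_on hG.le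
          (S.intervalIntegrable_totalDoppler_mul_flux ha _ le_rfl hG.le)
          ((S.intervalIntegrable_flux ha le_rfl hG.le).const_mul _) hle
    _ = M * Real.exp C * (∫ θ in t₀..timeAdvance a t₀, S.flux θ) * Real.exp (μ * m) := by
        rw [intervalIntegral.integral_const_mul]; ring
    _ ≤ _ := mul_le_mul_of_nonneg_right (by linarith) (Real.exp_pos _).le

end CavityField

theorem mainTheorem1 (a : ℝ → ℝ) (ha : IsMirrorMotion a) (p q : ℕ) (hq : 0 < q)
    (hrot : HasRotationNumber (timeAdvance a) ((p : ℝ) / (q : ℝ)))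
    (θ₁ : ℝ) (hper : IsPeriodicPhase a q θ₁) (hstable : deriv ((timeAdvance a)^[q]) θ₁ < 1)
    (t₀ : ℝ) (S : CavityField a t₀)
    (hfield : ∃ φ, S.FirstReflection φ ∧ InBasin a q θ₁ φ) :
    1 < totalDoppler a q θ₁ ∧
    (fun t : ℝ => Real.exp (Real.log (totalDoppler a q θ₁) / p * t)) =O[atTop] S.energy ∧
    ((∀ θ', IsPeriodicPhase a q θ' → (∃ φ, S.FirstReflection φ ∧ InBasin a q θ' φ) →
        totalDoppler a q θ' ≤ totalDoppler a q θ₁) →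
      S.energy =Θ[atTop]
        (fun t : ℝ => Real.exp (Real.log (totalDoppler a q θ₁) / p * t))) := by
  obtain ⟨ℓ, L, h⟩ := ha.exists_isCircleLift_returnMap q p
  have hθ₁ := ha.returnMap_eq_of_hasRotationNumber hq hrot hper
  have hpos := ha.totalDoppler_pos q θ₁
  have hℓθ := ha.log_deriv_returnMap h hθ₁
  have hμ : 0 < Real.log (totalDoppler a q θ₁) := by
    have h1 : deriv (returnMap a q p) θ₁ = deriv (timeAdvance a)^[q] θ₁ :=
      deriv_sub_const (p : ℝ)
    rw [← h1, (h.hasDerivAt θ₁).deriv, Real.exp_lt_one_iff, hℓθ] at hstable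
    linarith
  set μ := Real.log (totalDoppler a q θ₁) with hμdef
  have hlower : (fun t : ℝ => Real.exp (μ / p * t)) =O[atTop] S.energy := by
    obtain ⟨φ, hφ, hbasin⟩ := hfield
    obtain ⟨hφm, hne⟩ := (S.firstReflection_iff ha).1 hφ
    obtain ⟨β, hβ, hlim⟩ := h.exists_tendsto_iterate hθ₁ φ
    obtain ⟨i, k, hik⟩ := ha.limit_of_inBasin hq hbasin hlim
    have hD : totalDoppler a q β = totalDoppler a q θ₁ := by
      rw [hik, ha.totalDoppler_add_int, ha.totalDoppler_iterate (k := p)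
        (by exact_mod_cast IsMirrorMotion.returnMap_eq_iff.1 hθ₁)]
    have hβμ : μ + ℓ β = 0 := by
      rw [ha.log_deriv_returnMap h hβ, hD, add_neg_cancel]
    obtain ⟨c, hc, hcE⟩ := S.exists_exp_le_energy ha h hβ hμ hβμ hlim hφm hne
    obtain ⟨K, hK, hKE⟩ := S.exists_energy_compare ha hq hθ₁ hμ
    refine IsBigO.of_bound (K * (c⁻¹ * K)) ?_
    filter_upwards [eventually_ge_atTop t₀] with t ht
    obtain ⟨m, -, h2, h3, -⟩ := hKE t ht
    rw [Real.norm_of_nonneg (Real.exp_pos _).le, Real.norm_of_nonneg (S.energy_nonneg ha ht)]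
    have h4 : Real.exp (μ * m) ≤ c⁻¹ * (K * S.energy t) := by
      rw [← div_eq_inv_mul, le_div_iff₀' hc]
      exact (hcE m).trans h2
    calc _ ≤ _ := h3
      _ ≤ _ := mul_le_mul_of_nonneg_left h4 hK.le
      _ = _ := by ring
  refine ⟨(Real.log_pos_iff hpos.le).1 hμ, hlower, fun hdom => ⟨?_, hlower⟩⟩
  obtain ⟨C, hC, hCE⟩ := S.exists_energy_le_exp ha h hθ₁ hμ fun θ hθ hne β hβ hlim => by
    have h1 := hdom β (IsMirrorMotion.isPeriodicPhase_of_returnMap_eq hβ)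
      ⟨θ, (S.firstReflection_iff ha).2 ⟨hθ, hne⟩, ha.inBasin_of_tendsto hq hlim⟩
    have h2 := Real.log_le_log (ha.totalDoppler_pos q β) h1
    rw [ha.log_deriv_returnMap h hβ]
    linarith
  obtain ⟨K, hK, hKE⟩ := S.exists_energy_compare ha hq hθ₁ hμ
  refine IsBigO.of_bound (K * (C * K)) ?_
  filter_upwards [eventually_ge_atTop t₀] with t ht
  obtain ⟨m, h1, -, -, h4⟩ := hKE t ht
  rw [Real.norm_of_nonneg (Real.exp_pos _).le, Real.norm_of_nonneg (S.energy_nonneg ha ht)]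
  calc _ ≤ _ := h1
    _ ≤ _ := mul_le_mul_of_nonneg_left (hCE m) hK.le
    _ ≤ _ := mul_le_mul_of_nonneg_left (mul_le_mul_of_nonneg_left h4 hC.le) hK.le
    _ = _ := by ring
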